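/- Work in discrete time. Let $\mathcal R_p$ and $\mathcal{RH}_\infty$ denote the sets of proper, respectively stable proper, real-rational transfer matrices in $z$ (stable: all poles in the open unit disc), and let $\|\mathbf G\|_\infty=\sup_{|z|=1}\sigma_{\max}(\mathbf G(z))$. Let $A\in\mathbb R^{n\times n}$, $B\in\mathbb R^{n\times m}$, $C\in\mathbb R^{p\times n}$, $D\in\mathbb R^{p\times m}$ and $\epsilon>0$. For $\mathbf\Delta_A,\mathbf\Delta_B,\mathbf\Delta_C,\mathbf\Delta_D\in\mathcal{RH}_\infty$ of matching dimensions put $$\mathbf\Delta=\begin{bmatrix}\mathbf\Delta_A&\mathbf\Delta_B&O\\O&O&O\\\mathbf\Delta_C&\mathbf\Delta_D&O\end{bmatrix},$$ and say that a controller $\mathbf K\in\mathcal R_p$ internally stabilizes the perturbed output-feedback plant $\mathbf G(\mathbf\Delta)=(A+\mathbf\Delta_A,B+\mathbf\Delta_B,C+\mathbf\Delta_C,D+\mathbf\Delta_D)$ if $$\begin{bmatrix}zI-A-\mathbf\Delta_A&-B-\mathbf\Delta_B&O\\O&I&-\mathbf K\\-C-\mathbf\Delta_C&-D-\mathbf\Delta_D&I\end{bmatrix}$$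 is invertible with inverse in $\mathcal{RH}_\infty$. Let $$\mathcal K_\epsilon=\{\mathbf K\in\mathcal R_p:\ \mathbf K\text{ internally stabilizes }\mathbf G(\mathbf\Delta)\text{ for all such }\mathbf\Delta\text{ with }\|\mathbf\Delta\|_\infty<\epsilon\}.$$ Then $\mathcal K_\epsilon$ is parameterized by the quadruples $\{\hat{\mathbf\Phi}_{xx},\hat{\mathbf\Phi}_{ux},\hat{\mathbf\Phi}_{xy},\hat{\mathbf\Phi}_{uy}\}$ of transfer matrices that satisfy the SLS constraints $$\begin{bmatrix}zI-A&-B\end{bmatrix}\begin{bmatrix}\hat{\mathbf\Phi}_{xx}&\hat{\mathbf\Phi}_{xy}\\\hat{\mathbf\Phi}_{ux}&\hat{\mathbf\Phi}_{uy}\end{bmatrix}=\begin{bmatrix}I&O\end{bmatrix},\qquad\begin{bmatrix}\hat{\mathbf\Phi}_{xx}&\hat{\mathbf\Phi}_{xy}\\\hat{\mathbf\Phi}_{ux}&\hat{\mathbf\Phi}_{uy}\end{bmatrix}\begin{bmatrix}zI-A\\-C\end{bmatrix}=\begin{bmatrix}I\\O\end{bmatrix},$$ $$\hat{\mathbf\Phi}_{xx},\hat{\mathbf\Phi}_{xy},\hat{\mathbf\Phi}_{ux}\in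 z^{-1}\mathcal{RH}_\infty,\qquad\hat{\mathbf\Phi}_{uy}\in\mathcal{RH}_\infty,$$ the norm bound $$\left\|\begin{bmatrix}\hat{\mathbf\Phi}_{xx}&\hat{\mathbf\Phi}_{xy}\\\hat{\mathbf\Phi}_{ux}&\hat{\mathbf\Phi}_{uy}\end{bmatrix}\right\|_\infty\le\epsilon^{-1},$$ and the well-posedness condition that $I+D\hat{\mathbf K}_0$ is invertible with inverse in $\mathcal R_p$ (automatic if $D=O$), where $\hat{\mathbf K}_0=\hat{\mathbf\Phi}_{uy}-\hat{\mathbf\Phi}_{ux}\hat{\mathbf\Phi}_{xx}^{-1}\hat{\mathbf\Phi}_{xy}$. The controller of such a quadruple is $\hat{\mathbf K}=\hat{\mathbf K}_0(I+D\hat{\mathbf K}_0)^{-1}$, and the map from quadruples to controllers is a bijection onto $\mathcal K_\epsilon$. -/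

import Mathlib

open scoped ENNReal Matrix

noncomputable section

namespace RobustSLS

/-- A real-rational (discrete-time) transfer matrix, in the variable `z = RatFunc.X`. -/
abbrev TransferMatrix (ι κ : Type) : Type := Matrix ι κ (RatFunc ℝ)

/-- The constant transfer matrix given by a real matrix. -/
def const {ι κ : Type} (M : Matrix ι κ ℝ) : TransferMatrix ι κ := M.map RatFunc.C

/-- A rational function is proper if the degree of its numerator does not exceed
the degree of its denominator. -/
def IsProperFun (f : RatFunc ℝ) : Prop := f.num.natDegree ≤ f.denom.natDegree

/-- A rational function is stable (discrete time) if all its complex poles lie in the open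
unit disc; `num` and `denom` are coprime, so the poles are the roots of `denom`. -/
def IsStableFun (f : RatFunc ℝ) : Prop :=
  ∀ w : ℂ, Polynomial.aeval w f.denom = 0 → ‖w‖ < 1

/-- The set `R_p` of proper transfer matrices. -/
def IsProper {ι κ : Type} (G : TransferMatrix ι κ) : Prop := ∀ i j, IsProperFun (G i j)

/-- The set `RH_∞` of stable proper transfer matrices. -/
def IsRHInf {ι κ : Type} (G : TransferMatrix ι κ) : Prop :=
  ∀ i j, IsProperFun (G i j) ∧ IsStableFun (G i j)

/-- The set `z⁻¹ RH_∞` of strictly proper stable transfer matrices. -/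
def IsZInvRHInf {ι κ : Type} (G : TransferMatrix ι κ) : Prop :=
  ∃ H : TransferMatrix ι κ, IsRHInf H ∧ G = (RatFunc.X : RatFunc ℝ)⁻¹ • H

/-- The value of a transfer matrix at a complex point. -/
def evalAt {ι κ : Type} (w : ℂ) (G : TransferMatrix ι κ) : Matrix ι κ ℂ :=
  G.map (RatFunc.eval (algebraMap ℝ ℂ) w)

open scoped Matrix.Norms.L2Operator in
/-- The `H_∞` norm `sup_{|w| = 1} σ_max (G w)`: the largest singular value is the operator norm
with respect to the Euclidean norms. -/
def hInfNorm {ι κ : Type} [Fintype ι] [Fintype κ] [DecidableEq κ]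
    (G : TransferMatrix ι κ) : ℝ≥0∞ :=
  ⨆ w : Metric.sphere (0 : ℂ) 1, ‖evalAt (w : ℂ) G‖ₑ

/-- A transfer matrix on `(x, u, y)` assembled from its nine blocks. -/
def blocks₃ {n m p : ℕ}
    (Mxx : TransferMatrix (Fin n) (Fin n)) (Mxu : TransferMatrix (Fin n) (Fin m))
    (Mxy : TransferMatrix (Fin n) (Fin p))
    (Mux : TransferMatrix (Fin m) (Fin n)) (Muu : TransferMatrix (Fin m) (Fin m))
    (Muy : TransferMatrix (Fin m) (Fin p))
    (Myx : TransferMatrix (Fin p) (Fin n)) (Myu : TransferMatrix (Fin p) (Fin m))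
    (Myy : TransferMatrix (Fin p) (Fin p)) :
    TransferMatrix (Fin n ⊕ Fin m ⊕ Fin p) (Fin n ⊕ Fin m ⊕ Fin p) :=
  Matrix.fromRows (Matrix.fromCols Mxx (Matrix.fromCols Mxu Mxy))
    (Matrix.fromRows (Matrix.fromCols Mux (Matrix.fromCols Muu Muy))
      (Matrix.fromCols Myx (Matrix.fromCols Myu Myy)))

/-- The realization matrix `R` of the output-feedback system with internal signals
`(x, u, y)`: `z x = A x + B u`, `u = K y`, `y = C x + D u` (up to additive disturbances), that is
`I - R = [zI - A, -B, O; O, I, -K; -C, -D, I]`. The plant data may be transfer matrices, so as to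
cover perturbed plants. -/
def realization {n m p : ℕ}
    (A : TransferMatrix (Fin n) (Fin n)) (B : TransferMatrix (Fin n) (Fin m))
    (C : TransferMatrix (Fin p) (Fin n)) (D : TransferMatrix (Fin p) (Fin m))
    (K : TransferMatrix (Fin m) (Fin p)) :
    TransferMatrix (Fin n ⊕ Fin m ⊕ Fin p) (Fin n ⊕ Fin m ⊕ Fin p) :=
  blocks₃
    (1 - ((RatFunc.X : RatFunc ℝ) • (1 : TransferMatrix (Fin n) (Fin n)) - A)) B 0
    0 0 K
    C D 0

/-- The controller `K` internally stabilizes the plant `(A, B, C, D)`: the internal stability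
matrix `S`, i.e. the map `d ↦ η` defined by `η = R η + d`, exists and lies in `RH_∞`. -/
def InternallyStabilizes {n m p : ℕ}
    (A : TransferMatrix (Fin n) (Fin n)) (B : TransferMatrix (Fin n) (Fin m))
    (C : TransferMatrix (Fin p) (Fin n)) (D : TransferMatrix (Fin p) (Fin m))
    (K : TransferMatrix (Fin m) (Fin p)) : Prop :=
  ∃ S : TransferMatrix (Fin n ⊕ Fin m ⊕ Fin p) (Fin n ⊕ Fin m ⊕ Fin p),
    (1 - realization A B C D K) * S = 1 ∧ S * (1 - realization A B C D K) = 1 ∧ IsRHInf S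

/-- The structured additive perturbation of the realization that changes `(A, B, C, D)` into
`(A + ΔA, B + ΔB, C + ΔC, D + ΔD)`. -/
def structuredPerturbation {n m p : ℕ}
    (ΔA : TransferMatrix (Fin n) (Fin n)) (ΔB : TransferMatrix (Fin n) (Fin m))
    (ΔC : TransferMatrix (Fin p) (Fin n)) (ΔD : TransferMatrix (Fin p) (Fin m)) :
    TransferMatrix (Fin n ⊕ Fin m ⊕ Fin p) (Fin n ⊕ Fin m ⊕ Fin p) :=
  blocks₃ ΔA ΔB 0 0 0 0 ΔC ΔD 0

/-- The set `K_ε` of robustly stabilizing controllers: the proper `K` that internally stabilize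
the perturbed plant for every structured perturbation in `RH_∞` of `H_∞` norm less than `ε`. -/
def robustControllers {n m p : ℕ}
    (A : Matrix (Fin n) (Fin n) ℝ) (B : Matrix (Fin n) (Fin m) ℝ)
    (C : Matrix (Fin p) (Fin n) ℝ) (D : Matrix (Fin p) (Fin m) ℝ) (ε : ℝ) :
    Set (TransferMatrix (Fin m) (Fin p)) :=
  {K | IsProper K ∧
    ∀ (ΔA : TransferMatrix (Fin n) (Fin n)) (ΔB : TransferMatrix (Fin n) (Fin m))
      (ΔC : TransferMatrix (Fin p) (Fin n)) (ΔD : TransferMatrix (Fin p) (Fin m)),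
      IsRHInf ΔA → IsRHInf ΔB → IsRHInf ΔC → IsRHInf ΔD →
      hInfNorm (structuredPerturbation ΔA ΔB ΔC ΔD) < ENNReal.ofReal ε →
      InternallyStabilizes (const A + ΔA) (const B + ΔB) (const C + ΔC) (const D + ΔD) K}

/-- A quadruple of transfer matrices `{Φxx, Φux, Φxy, Φuy}` (the shape of an output-feedback
system level parameter). -/
@[ext]
structure SLP (n m p : ℕ) where
  xx : TransferMatrix (Fin n) (Fin n)
  xy : TransferMatrix (Fin n) (Fin p)
  ux : TransferMatrix (Fin m) (Fin n)
  uy : TransferMatrix (Fin m) (Fin p)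

/-- The transfer matrix `[Φxx, Φxy; Φux, Φuy]`. -/
def SLP.toMatrix {n m p : ℕ} (Φ : SLP n m p) :
    TransferMatrix (Fin n ⊕ Fin m) (Fin n ⊕ Fin p) :=
  Matrix.fromBlocks Φ.xx Φ.xy Φ.ux Φ.uy

/-- The output-feedback SLS constraints:
`[zI - A, -B] Φ = [I, O]`, `Φ [zI - A; -C] = [I; O]`, `Φxx, Φxy, Φux ∈ z⁻¹ RH_∞`,
`Φuy ∈ RH_∞`. -/
structure SLP.SatisfiesSLS {n m p : ℕ} (A : Matrix (Fin n) (Fin n) ℝ)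
    (B : Matrix (Fin n) (Fin m) ℝ) (C : Matrix (Fin p) (Fin n) ℝ) (Φ : SLP n m p) : Prop where
  left : Matrix.fromCols
      ((RatFunc.X : RatFunc ℝ) • (1 : TransferMatrix (Fin n) (Fin n)) - const A) (-const B) *
      Φ.toMatrix = Matrix.fromCols 1 0
  right : Φ.toMatrix * Matrix.fromRows
      ((RatFunc.X : RatFunc ℝ) • (1 : TransferMatrix (Fin n) (Fin n)) - const A) (-const C) =
      Matrix.fromRows 1 0
  xx_mem : IsZInvRHInf Φ.xx
  xy_mem : IsZInvRHInf Φ.xy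
  ux_mem : IsZInvRHInf Φ.ux
  uy_mem : IsRHInf Φ.uy

/-- `K₀ = Φuy - Φux Φxx⁻¹ Φxy`. -/
def SLP.controller₀ {n m p : ℕ} (Φ : SLP n m p) : TransferMatrix (Fin m) (Fin p) :=
  Φ.uy - Φ.ux * Φ.xx⁻¹ * Φ.xy

/-- The controller `K = K₀ (I + D K₀)⁻¹` attached to a system level parameter. -/
def SLP.controller {n m p : ℕ} (D : Matrix (Fin p) (Fin m) ℝ) (Φ : SLP n m p) :
    TransferMatrix (Fin m) (Fin p) :=
  Φ.controller₀ * (1 + const D * Φ.controller₀)⁻¹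

/-- The controller formula is well posed: `I + D K₀` is invertible with proper inverse.
(Automatic if `D = O`.) -/
def SLP.IsWellPosed {n m p : ℕ} (D : Matrix (Fin p) (Fin m) ℝ) (Φ : SLP n m p) : Prop :=
  IsUnit (1 + const D * Φ.controller₀) ∧ IsProper (1 + const D * Φ.controller₀)⁻¹

/-- The system level parameters that satisfy the SLS constraints, for which the controller is
well posed, and with `‖[Φxx, Φxy; Φux, Φuy]‖_∞ ≤ ε⁻¹`. -/
def robustSLPs {n m p : ℕ}
    (A : Matrix (Fin n) (Fin n) ℝ) (B : Matrix (Fin n) (Fin m) ℝ)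
    (C : Matrix (Fin p) (Fin n) ℝ) (D : Matrix (Fin p) (Fin m) ℝ) (ε : ℝ) :
    Set (SLP n m p) :=
  {Φ | Φ.SatisfiesSLS A B C ∧ Φ.IsWellPosed D ∧ hInfNorm Φ.toMatrix ≤ ENNReal.ofReal ε⁻¹}

end RobustSLS

end

/-!
A controller `K` closes the loop `η = R η + d` on the signals `(x, u, y)`, and it stabilizes the
nominal plant when `I - R` has an inverse `S` in `RH_∞`. Let `Φ` be the part of `S` that maps the
disturbances on `(x, y)` to `(x, u)`.

*Parameterization of the nominal loops.* Reading `(I - R) S = I` and `S (I - R) = I` blockwise shows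
that `Φ` satisfies the SLS constraints, and that `Syy - Syx Φxx⁻¹ Φxy = I + D K₀` is inverse to
`I - D K`; hence `K = K₀ (I + D K₀)⁻¹` (`exists_SLP_of_internallyStabilizes`). Conversely, the
constraints make `Φ` extend to an inverse of `I - R` for its own controller
(`SLP.SatisfiesSLS.one_sub_realization_mul_loop`). Inverses being unique, the controller
determines `Φ`. Invertibility of `Φxx`, and properness of the controller, come from
`Φxx = z⁻¹ (I + z⁻¹ P)` with `P` proper: the determinant of `I + z⁻¹ P` is a unit of the local ring
of proper functions (`isUnit_one_add_inv_X_smul`).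

*Robustness.* A structured perturbation is `Δ = E δ F`, where `E` and `F` select the signals
`(x, y)` and `(x, u)`, and `Φ = F S E`. So `I - R - Δ` is invertible over `RH_∞` as soon as
`I - Φ δ` is, with inverse `S + S E δ (I - Φ δ)⁻¹ F S`. If `‖Φ‖_∞ ≤ ε⁻¹` and `‖δ‖_∞ < ε`, this is the
small gain theorem (`isUnit_one_sub_of_norm_le`): by the maximum modulus principle in the variable
`1 / z`, `det (I - Φ δ)` has no zero in `1 ≤ |z| ≤ ∞`. If instead `‖Φ z‖ > ε⁻¹` at some point `z` of
the circle, which by continuity may be taken non-real, a rank-one `δ` with entries of constant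
modulus on the circle, built from the all-pass functions `(1 - a z) / (z - a)`, has norm less than
`ε` and makes `I - δ Φ` singular at `z` (`exists_destabilizing`). But if the perturbed loop is
stable, with response `Φ'`, then `I + δ Φ'` is a stable inverse of `I - δ Φ`, a contradiction.
-/

namespace RobustSLS

/-! ### Proper and stable rational functions -/

theorem isProperFun_iff_intDegree_nonpos {f : RatFunc ℝ} : IsProperFun f ↔ f.intDegree ≤ 0 := by
  unfold IsProperFun RatFunc.intDegree
  omega

open scoped Classical in
theorem isProperFun_iff_inftyValuation_le_one {f : RatFunc ℝ} :
    IsProperFun f ↔ RatFunc.inftyValuation ℝ f ≤ 1 := by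
  by_cases hf : f = 0
  · simp [hf, IsProperFun]
  · rw [isProperFun_iff_intDegree_nonpos, RatFunc.inftyValuation_apply,
      RatFunc.inftyValuation_of_nonzero ℝ hf, ← WithZero.exp_zero, WithZero.exp_le_exp]

open scoped Classical in
/-- The valuation ring of proper rational functions. -/
noncomputable def properRing : ValuationSubring (RatFunc ℝ) :=
  (RatFunc.inftyValuation ℝ).valuationSubring

theorem mem_properRing {f : RatFunc ℝ} : f ∈ properRing ↔ IsProperFun f :=
  by
  classical
  exact isProperFun_iff_inftyValuation_le_one.symm

theorem IsStableFun.of_denom_dvd {f g h : RatFunc ℝ} (hf : IsStableFun f) (hg : IsStableFun g)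
    (hd : h.denom ∣ f.denom * g.denom) : IsStableFun h := by
  intro w hw
  have := Polynomial.aeval_eq_zero_of_dvd_aeval_eq_zero hd hw
  rw [map_mul, mul_eq_zero] at this
  exact this.elim (hf w) (hg w)

theorem isStableFun_C (c : ℝ) : IsStableFun (RatFunc.C c) := by
  intro w hw
  simp at hw

/-- The ring of stable proper rational functions. -/
noncomputable def rhInfRing : Subring (RatFunc ℝ) where
  carrier := {f | IsProperFun f ∧ IsStableFun f}
  mul_mem' ha hb := ⟨mem_properRing.1 (mul_mem (mem_properRing.2 ha.1) (mem_properRing.2 hb.1)),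
    ha.2.of_denom_dvd hb.2 (RatFunc.denom_mul_dvd _ _)⟩
  one_mem' := ⟨mem_properRing.1 (one_mem _), by simpa using isStableFun_C 1⟩
  add_mem' ha hb := ⟨mem_properRing.1 (add_mem (mem_properRing.2 ha.1) (mem_properRing.2 hb.1)),
    ha.2.of_denom_dvd hb.2 (RatFunc.denom_add_dvd _ _)⟩
  zero_mem' := ⟨mem_properRing.1 (zero_mem _), by simpa using isStableFun_C 0⟩
  neg_mem' {a} ha := by
    refine ⟨mem_properRing.1 (neg_mem (mem_properRing.2 ha.1)), ?_⟩
    refine (isStableFun_C (-1)).of_denom_dvd ha.2 ?_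
    simpa using RatFunc.denom_mul_dvd (RatFunc.C (-1)) a

theorem C_mem_rhInfRing (c : ℝ) : RatFunc.C c ∈ rhInfRing :=
  ⟨by simp [IsProperFun], isStableFun_C c⟩

theorem inv_X_mem_properRing : (RatFunc.X : RatFunc ℝ)⁻¹ ∈ properRing := by
  rw [mem_properRing, isProperFun_iff_intDegree_nonpos, RatFunc.intDegree_inv]
  simp

theorem X_notMem_properRing : (RatFunc.X : RatFunc ℝ) ∉ properRing := by
  rw [mem_properRing, isProperFun_iff_intDegree_nonpos]
  simp

theorem denom_inv_X : (RatFunc.X : RatFunc ℝ)⁻¹.denom ∣ Polynomial.X := by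
  simpa using RatFunc.denom_inv_dvd (K := ℝ) RatFunc.X_ne_zero

theorem inv_X_mem_rhInfRing : (RatFunc.X : RatFunc ℝ)⁻¹ ∈ rhInfRing := by
  refine ⟨mem_properRing.1 inv_X_mem_properRing, fun w hw => ?_⟩
  have := Polynomial.aeval_eq_zero_of_dvd_aeval_eq_zero denom_inv_X hw
  rw [Polynomial.aeval_X] at this
  simp [this]

theorem aeval_denom_ne_zero {f : RatFunc ℝ} (hf : f ∈ rhInfRing) {w : ℂ} (hw : 1 ≤ ‖w‖) :
    Polynomial.eval₂ (algebraMap ℝ ℂ) w f.denom ≠ 0 :=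
  fun h => (hf.2 w h).not_ge hw

/-- Evaluation of stable proper rational functions at a point outside the open unit disc. -/
noncomputable def evalHom (w : ℂ) (hw : 1 ≤ ‖w‖) : rhInfRing →+* ℂ where
  toFun f := RatFunc.eval (algebraMap ℝ ℂ) w f
  map_one' := by simp
  map_zero' := by simp
  map_mul' f g := RatFunc.eval_mul _ _ (aeval_denom_ne_zero f.2 hw) (aeval_denom_ne_zero g.2 hw)
  map_add' f g := RatFunc.eval_add _ _ (aeval_denom_ne_zero f.2 hw) (aeval_denom_ne_zero g.2 hw)

/-! ### Stable proper functions on the closed disc, in the variable `1 / z` -/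

/-- The function `w ↦ f (1 / w)`, with the value at infinity of `f` filled in at `w = 0` when `f`
is proper. -/
noncomputable def discFun (f : RatFunc ℝ) (w : ℂ) : ℂ :=
  Polynomial.aeval w (f.num.reflect f.denom.natDegree) /
    Polynomial.aeval w (f.denom.reflect f.denom.natDegree)

theorem discFun_of_ne_zero {f : RatFunc ℝ} (hf : IsProperFun f) {w : ℂ} (hw : w ≠ 0) :
    discFun f w = RatFunc.eval (algebraMap ℝ ℂ) w⁻¹ f := by
  let _ : Invertible w⁻¹ := invertibleOfNonzero (inv_ne_zero hw)
  have key (q : Polynomial ℝ) (hq : q.natDegree ≤ f.denom.natDegree) :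
      Polynomial.aeval w (q.reflect f.denom.natDegree) * w⁻¹ ^ f.denom.natDegree =
        Polynomial.eval₂ (algebraMap ℝ ℂ) w⁻¹ q := by
    have h := Polynomial.eval₂_reflect_mul_pow (algebraMap ℝ ℂ) w⁻¹ _ q hq
    rwa [invOf_eq_inv, inv_inv] at h
  rw [discFun, RatFunc.eval, ← key _ hf, ← key _ le_rfl,
    mul_div_mul_right _ _ (pow_ne_zero _ (inv_ne_zero hw))]

theorem discFun_denom_ne_zero {f : RatFunc ℝ} (hf : f ∈ rhInfRing) {w : ℂ} (hw : ‖w‖ ≤ 1) :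
    Polynomial.aeval w (f.denom.reflect f.denom.natDegree) ≠ 0 := by
  by_cases h0 : w = 0
  · simp [h0, ← Polynomial.coeff_zero_eq_aeval_zero', Polynomial.coeff_reflect,
      f.monic_denom.coeff_natDegree]
  · let _ : Invertible w⁻¹ := invertibleOfNonzero (inv_ne_zero h0)
    have h := Polynomial.eval₂_reflect_mul_pow (algebraMap ℝ ℂ) w⁻¹ _ f.denom le_rfl
    rw [invOf_eq_inv, inv_inv] at h
    intro h1
    refine aeval_denom_ne_zero hf (w := w⁻¹) ?_ ?_
    · rw [norm_inv]
      exact (one_le_inv₀ (norm_pos_iff.2 h0)).2 hw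
    · rw [← h]
      exact mul_eq_zero_of_left h1 _

theorem discFun_zero (f : RatFunc ℝ) : discFun f 0 = f.num.coeff f.denom.natDegree := by
  simp [discFun, ← Polynomial.coeff_zero_eq_aeval_zero', Polynomial.coeff_reflect,
    f.monic_denom.coeff_natDegree]

theorem differentiableAt_discFun {f : RatFunc ℝ} (hf : f ∈ rhInfRing) {w : ℂ} (hw : ‖w‖ ≤ 1) :
    DifferentiableAt ℂ (discFun f) w :=
  (Polynomial.differentiable_aeval _).differentiableAt.div
    (Polynomial.differentiable_aeval _).differentiableAt (discFun_denom_ne_zero hf hw)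

/-- A stable proper function without zeros in `1 ≤ ‖z‖ ≤ ∞` is invertible in `RH_∞`. -/
theorem inv_mem_rhInfRing {f : RatFunc ℝ} (hf : f ∈ rhInfRing)
    (h : ∀ w : ℂ, ‖w‖ ≤ 1 → discFun f w ≠ 0) : f⁻¹ ∈ rhInfRing := by
  have h0 : f.num.coeff f.denom.natDegree ≠ 0 := by
    simpa [discFun_zero] using h 0 (by simp)
  have hf0 : f ≠ 0 := by
    rintro rfl
    simp at h0
  refine ⟨?_, fun w hw => ?_⟩
  · rw [isProperFun_iff_intDegree_nonpos, RatFunc.intDegree_inv, RatFunc.intDegree]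
    have := Polynomial.le_natDegree_of_ne_zero h0
    omega
  · by_contra! hw1
    have hw0 : w ≠ 0 := norm_pos_iff.1 (by linarith)
    refine h w⁻¹ ?_ ?_
    · rw [norm_inv]
      exact inv_le_one_of_one_le₀ hw1
    · rw [discFun_of_ne_zero hf.1 (inv_ne_zero hw0), inv_inv, RatFunc.eval]
      have := Polynomial.aeval_eq_zero_of_dvd_aeval_eq_zero (RatFunc.denom_inv_dvd hf0) hw
      rw [show Polynomial.eval₂ (algebraMap ℝ ℂ) w f.num = 0 from this, zero_div]

/-! ### Transfer matrices with entries in a ring -/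

section Entries

variable {ι κ μ : Type} {R : Subring (RatFunc ℝ)}

/-- All entries of the transfer matrix `G` lie in the ring `R`. -/
def EntriesIn (R : Subring (RatFunc ℝ)) (G : TransferMatrix ι κ) : Prop := ∀ i j, G i j ∈ R

theorem isRHInf_iff {G : TransferMatrix ι κ} : IsRHInf G ↔ EntriesIn rhInfRing G := Iff.rfl

theorem isProper_iff {G : TransferMatrix ι κ} :
    IsProper G ↔ EntriesIn properRing.toSubring G :=
  forall₂_congr fun _ _ => mem_properRing.symm

theorem IsRHInf.isProper {G : TransferMatrix ι κ} (hG : IsRHInf G) : IsProper G :=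
  fun i j => (hG i j).1

theorem EntriesIn.exists_map {G : TransferMatrix ι κ} (hG : EntriesIn R G) :
    ∃ G' : Matrix ι κ R, G'.map R.subtype = G :=
  ⟨Matrix.of fun i j => ⟨G i j, hG i j⟩, rfl⟩

theorem EntriesIn.add {G H : TransferMatrix ι κ} (hG : EntriesIn R G) (hH : EntriesIn R H) :
    EntriesIn R (G + H) := fun i j => R.add_mem (hG i j) (hH i j)

theorem EntriesIn.sub {G H : TransferMatrix ι κ} (hG : EntriesIn R G) (hH : EntriesIn R H) :
    EntriesIn R (G - H) := fun i j => R.sub_mem (hG i j) (hH i j)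

theorem EntriesIn.smul {f : RatFunc ℝ} {G : TransferMatrix ι κ} (hf : f ∈ R)
    (hG : EntriesIn R G) : EntriesIn R (f • G) := fun i j => R.mul_mem hf (hG i j)

theorem EntriesIn.mul [Fintype κ] {G : TransferMatrix ι κ} {H : TransferMatrix κ μ}
    (hG : EntriesIn R G) (hH : EntriesIn R H) : EntriesIn R (G * H) :=
  fun i j => R.sum_mem fun k _ => R.mul_mem (hG i k) (hH k j)

theorem entriesIn_zero : EntriesIn R (0 : TransferMatrix ι κ) := fun _ _ => R.zero_mem

theorem isRHInf_zero : IsRHInf (0 : TransferMatrix ι κ) :=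
  isRHInf_iff.2 entriesIn_zero

theorem entriesIn_one [DecidableEq ι] : EntriesIn R (1 : TransferMatrix ι ι) := by
  intro i j
  rw [Matrix.one_apply]
  split_ifs
  exacts [R.one_mem, R.zero_mem]

theorem entriesIn_const (M : Matrix ι κ ℝ) : EntriesIn rhInfRing (const M) :=
  fun i j => C_mem_rhInfRing (M i j)

theorem EntriesIn.det_mem [Fintype ι] [DecidableEq ι] {G : TransferMatrix ι ι}
    (hG : EntriesIn R G) : G.det ∈ R := by
  obtain ⟨G', rfl⟩ := hG.exists_map
  rw [← RingHom.mapMatrix_apply, ← RingHom.map_det]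
  exact G'.det.2

theorem EntriesIn.inv [Fintype ι] [DecidableEq ι] {G : TransferMatrix ι ι}
    (hG : EntriesIn R G) (hd : G.det⁻¹ ∈ R) : EntriesIn R G⁻¹ := by
  rw [Matrix.inv_def, Ring.inverse_eq_inv']
  refine EntriesIn.smul hd ?_
  obtain ⟨G', rfl⟩ := hG.exists_map
  rw [← RingHom.mapMatrix_apply, ← RingHom.map_adjugate]
  exact fun i j => (G'.adjugate i j).2

/-- A proper perturbation of the identity that vanishes at infinity is invertible over the
proper functions: its determinant reduces to `1` in the residue field at infinity. -/
theorem isUnit_one_add_inv_X_smul [Fintype ι] [DecidableEq ι] {P : TransferMatrix ι ι}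
    (hP : IsProper P) :
    IsUnit (1 + (RatFunc.X : RatFunc ℝ)⁻¹ • P) ∧
      IsProper (1 + (RatFunc.X : RatFunc ℝ)⁻¹ • P)⁻¹ := by
  obtain ⟨P', rfl⟩ := (isProper_iff.1 hP).exists_map
  let P₁ : Matrix ι ι properRing := P'
  let t : properRing := ⟨(RatFunc.X : RatFunc ℝ)⁻¹, inv_X_mem_properRing⟩
  have ht : t ∈ IsLocalRing.maximalIdeal properRing := by
    rw [IsLocalRing.mem_maximalIdeal, mem_nonunits_iff]
    intro hu
    obtain ⟨s, hs⟩ := hu.exists_right_inv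
    have hs' : (RatFunc.X : RatFunc ℝ)⁻¹ * s = 1 := congrArg Subtype.val hs
    have : (s : RatFunc ℝ) = RatFunc.X := by
      rw [inv_mul_eq_one₀ RatFunc.X_ne_zero] at hs'
      exact hs'.symm
    exact X_notMem_properRing (this ▸ s.2)
  have hu : IsUnit (1 + t • P₁).det := by
    rw [← isUnit_map_iff (IsLocalRing.residue properRing), RingHom.map_det]
    have : (IsLocalRing.residue properRing).mapMatrix (1 + t • P₁) = 1 := by
      have h0 : IsLocalRing.residue properRing t = 0 := (IsLocalRing.residue_eq_zero_iff t).2 ht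
      ext i j
      simp [Matrix.one_apply, h0, apply_ite]
    rw [this]
    simp
  have hmap : (1 : TransferMatrix ι ι) + (RatFunc.X : RatFunc ℝ)⁻¹ •
      P'.map properRing.toSubring.subtype = (1 + t • P₁).map properRing.subtype := by
    ext i j
    simp [Matrix.one_apply, apply_ite, P₁, t]
  have hdet : (1 + (RatFunc.X : RatFunc ℝ)⁻¹ • P'.map properRing.toSubring.subtype).det =
      properRing.subtype (1 + t • P₁).det := by
    rw [hmap, RingHom.map_det, RingHom.mapMatrix_apply]
  refine ⟨?_, isProper_iff.2 (EntriesIn.inv ?_ ?_)⟩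
  · rw [Matrix.isUnit_iff_isUnit_det, hdet]
    exact hu.map _
  · exact entriesIn_one.add (EntriesIn.smul inv_X_mem_properRing (isProper_iff.1 hP))
  · obtain ⟨s, hs⟩ := hu.exists_right_inv
    have : properRing.subtype (1 + t • P₁).det * properRing.subtype s = 1 := by
      rw [← map_mul, hs, map_one]
    rw [hdet, inv_eq_of_mul_eq_one_right this]
    exact s.2

end Entries

/-! ### Evaluation of transfer matrices -/

section Eval

variable {ι κ μ : Type} {w : ℂ}

theorem evalAt_map_subtype (hw : 1 ≤ ‖w‖) (G : Matrix ι κ rhInfRing) :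
    evalAt w (G.map rhInfRing.subtype) = G.map (evalHom w hw) := rfl

theorem evalAt_mul [Fintype κ] (hw : 1 ≤ ‖w‖) {G : TransferMatrix ι κ} {H : TransferMatrix κ μ}
    (hG : IsRHInf G) (hH : IsRHInf H) : evalAt w (G * H) = evalAt w G * evalAt w H := by
  obtain ⟨G, rfl⟩ := (isRHInf_iff.1 hG).exists_map
  obtain ⟨H, rfl⟩ := (isRHInf_iff.1 hH).exists_map
  rw [← Matrix.map_mul, evalAt_map_subtype hw, evalAt_map_subtype hw, evalAt_map_subtype hw,
    Matrix.map_mul]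

theorem evalAt_one [DecidableEq ι] : evalAt w (1 : TransferMatrix ι ι) = 1 := by
  ext i j
  simp [evalAt, Matrix.one_apply, apply_ite]

theorem evalAt_zero : evalAt w (0 : TransferMatrix ι κ) = 0 := by
  ext i j
  simp [evalAt]

theorem evalAt_sub (hw : 1 ≤ ‖w‖) {G H : TransferMatrix ι κ}
    (hG : IsRHInf G) (hH : IsRHInf H) : evalAt w (G - H) = evalAt w G - evalAt w H := by
  obtain ⟨G, rfl⟩ := (isRHInf_iff.1 hG).exists_map
  obtain ⟨H, rfl⟩ := (isRHInf_iff.1 hH).exists_map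
  ext i j
  exact map_sub (evalHom w hw) (G i j) (H i j)

theorem det_evalAt [Fintype ι] [DecidableEq ι] (hw : 1 ≤ ‖w‖) {G : TransferMatrix ι ι}
    (hG : IsRHInf G) : (evalAt w G).det = RatFunc.eval (algebraMap ℝ ℂ) w G.det := by
  obtain ⟨G, rfl⟩ := (isRHInf_iff.1 hG).exists_map
  rw [evalAt_map_subtype hw, ← RingHom.mapMatrix_apply, ← RingHom.map_det,
    ← RingHom.mapMatrix_apply, ← RingHom.map_det]
  rfl

/-- The matrix function `w ↦ G (1 / w)` on the closed unit disc. -/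
noncomputable def discAt (w : ℂ) (G : TransferMatrix ι κ) : Matrix ι κ ℂ :=
  G.map fun f => discFun f w

theorem discAt_of_ne_zero {G : TransferMatrix ι κ} (hG : IsProper G) (hw : w ≠ 0) :
    discAt w G = evalAt w⁻¹ G := by
  ext i j
  exact discFun_of_ne_zero (hG i j) hw

theorem discFun_det_one_sub [Fintype ι] [DecidableEq ι] {G : TransferMatrix ι ι}
    (hG : IsRHInf G) (hw : ‖w‖ ≤ 1) : discFun (1 - G).det w = (1 - discAt w G).det := by
  have hG1 : IsRHInf (1 - G) := isRHInf_iff.2 (entriesIn_one.sub hG)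
  have hd : (1 - G).det ∈ rhInfRing := EntriesIn.det_mem hG1
  have key (v : ℂ) (hv : ‖v‖ ≤ 1) (h0 : v ≠ 0) :
      discFun (1 - G).det v = (1 - discAt v G).det := by
    have hv' : 1 ≤ ‖v⁻¹‖ := by
      rw [norm_inv]
      exact (one_le_inv₀ (norm_pos_iff.2 h0)).2 hv
    rw [discFun_of_ne_zero hd.1 h0, discAt_of_ne_zero hG.isProper h0, ← det_evalAt hv' hG1,
      evalAt_sub hv' (isRHInf_iff.2 entriesIn_one) hG, evalAt_one]
  rcases eq_or_ne w 0 with rfl | h0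
  · -- both sides are continuous at `0` and agree near it
    have h1 : ContinuousAt (discFun (1 - G).det) 0 := (differentiableAt_discFun hd hw).continuousAt
    have h2 : ContinuousAt (fun v : ℂ => (1 - discAt v G).det) 0 := by
      have : ContinuousAt (fun v : ℂ => (1 - discAt v G)) 0 := by
        refine continuousAt_const.sub ?_
        exact continuousAt_pi.2 fun i => continuousAt_pi.2 fun j =>
          (differentiableAt_discFun (hG i j) hw).continuousAt
      exact (continuous_id.matrix_det.continuousAt).comp this
    refine tendsto_nhds_unique_of_eventuallyEq (h1.tendsto.mono_left nhdsWithin_le_nhds)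
      (h2.tendsto.mono_left nhdsWithin_le_nhds) (l := nhdsWithin 0 {0}ᶜ) ?_
    filter_upwards [self_mem_nhdsWithin, mem_nhdsWithin_of_mem_nhds
      (Metric.closedBall_mem_nhds (0 : ℂ) one_pos)] with v hv hv1
    exact key v (by simpa using hv1) hv
  · exact key w hw h0

open scoped Matrix.Norms.L2Operator in
/-- Maximum modulus principle on the exterior of the unit disc. -/
theorem norm_discAt_mulVec_le [Fintype ι] [Fintype κ] [DecidableEq κ] {G : TransferMatrix ι κ}
    (hG : IsRHInf G) {c : ℝ} (hc : ∀ w : ℂ, ‖w‖ = 1 → ‖evalAt w G‖ ≤ c) (hw : ‖w‖ ≤ 1)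
    (v : EuclideanSpace ℂ κ) : ‖WithLp.toLp 2 (discAt w G *ᵥ v.ofLp)‖ ≤ c * ‖v‖ := by
  refine Complex.norm_le_of_forall_mem_frontier_norm_le (U := Metric.ball 0 1)
    (f := fun w => WithLp.toLp 2 (discAt w G *ᵥ v.ofLp)) Metric.isBounded_ball ?_ ?_ ?_
  · apply DifferentiableOn.diffContOnCl
    rw [closure_ball _ one_ne_zero]
    intro u hu
    refine DifferentiableAt.differentiableWithinAt ?_
    rw [differentiableAt_euclidean]
    intro i
    simp only [Matrix.mulVec, dotProduct]
    refine DifferentiableAt.fun_sum fun j _ => DifferentiableAt.mul_const ?_ _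
    exact differentiableAt_discFun (hG i j) (by simpa using hu)
  · intro u hu
    rw [frontier_ball _ one_ne_zero, mem_sphere_zero_iff_norm] at hu
    have hu0 : u ≠ 0 := norm_pos_iff.1 (by simp [hu])
    simp only [discAt_of_ne_zero hG.isProper hu0]
    refine (Matrix.l2_opNorm_mulVec _ v).trans ?_
    gcongr
    exact hc _ (by simp [hu])
  · rw [closure_ball _ one_ne_zero]
    simpa using hw

open scoped Matrix.Norms.L2Operator in
/-- The small gain theorem. -/
theorem isUnit_one_sub_of_norm_le [Fintype ι] [DecidableEq ι] {G : TransferMatrix ι ι}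
    (hG : IsRHInf G) {c : ℝ} (hc1 : c < 1) (hc : ∀ w : ℂ, ‖w‖ = 1 → ‖evalAt w G‖ ≤ c) :
    IsUnit (1 - G) ∧ IsRHInf (1 - G)⁻¹ := by
  have hG1 : EntriesIn rhInfRing (1 - G) := entriesIn_one.sub hG
  have hne (w : ℂ) (hw : ‖w‖ ≤ 1) : discFun (1 - G).det w ≠ 0 := by
    rw [discFun_det_one_sub hG hw]
    intro h
    obtain ⟨v, hv0, hv⟩ := Matrix.exists_mulVec_eq_zero_iff.2 h
    rw [Matrix.sub_mulVec, Matrix.one_mulVec, sub_eq_zero] at hv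
    have h1 := norm_discAt_mulVec_le hG hc hw (WithLp.toLp 2 v)
    rw [← hv] at h1
    have h2 : 0 < ‖WithLp.toLp 2 v‖ := norm_pos_iff.2 (by simpa using hv0)
    nlinarith
  refine ⟨?_, hG1.inv (inv_mem_rhInfRing hG1.det_mem hne)⟩
  rw [Matrix.isUnit_iff_isUnit_det, isUnit_iff_ne_zero]
  intro h
  exact hne 0 (by simp) (by simp [h, discFun])

end Eval

/-! ### Boundary interpolation by all-pass functions -/

section Interpolation

open Polynomial in
/-- The all-pass function `(1 - a z) / (z - a)`. -/
noncomputable def blaschke (a : ℝ) : RatFunc ℝ :=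
  algebraMap ℝ[X] (RatFunc ℝ) (1 - C a * X) / algebraMap ℝ[X] (RatFunc ℝ) (X - C a)

theorem blaschke_mem_rhInfRing {a : ℝ} (ha : |a| < 1) : blaschke a ∈ rhInfRing := by
  have hq : (Polynomial.X - Polynomial.C a) ≠ 0 := Polynomial.X_sub_C_ne_zero a
  refine ⟨?_, fun w hw => ?_⟩
  · have hp : (1 - Polynomial.C a * Polynomial.X) ≠ 0 := by
      intro h
      simpa using congrArg (Polynomial.eval 0) h
    rw [isProperFun_iff_intDegree_nonpos, blaschke,
      RatFunc.intDegree_div (RatFunc.algebraMap_ne_zero hp) (RatFunc.algebraMap_ne_zero hq),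
      RatFunc.intDegree_polynomial, RatFunc.intDegree_polynomial, Polynomial.natDegree_X_sub_C]
    have : (1 - Polynomial.C a * Polynomial.X).natDegree ≤ 1 := by compute_degree
    omega
  · have := Polynomial.aeval_eq_zero_of_dvd_aeval_eq_zero (RatFunc.denom_div_dvd _ _) hw
    simp only [map_sub, Polynomial.aeval_X, Polynomial.aeval_C, sub_eq_zero] at this
    simpa [this] using ha

theorem eval_blaschke_mul {a : ℝ} (ha : |a| < 1) {w : ℂ} (hw : ‖w‖ = 1) :
    RatFunc.eval (algebraMap ℝ ℂ) w (blaschke a) * (w - a) = 1 - a * w := by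
  have h : blaschke a * algebraMap _ (RatFunc ℝ) (Polynomial.X - Polynomial.C a) =
      algebraMap _ (RatFunc ℝ) (1 - Polynomial.C a * Polynomial.X) :=
    div_mul_cancel₀ _ (RatFunc.algebraMap_ne_zero (Polynomial.X_sub_C_ne_zero a))
  have h' := congrArg (RatFunc.eval (algebraMap ℝ ℂ) w) h
  rw [RatFunc.eval_mul _ _ (aeval_denom_ne_zero (blaschke_mem_rhInfRing ha) hw.ge)
    (by rw [RatFunc.denom_algebraMap]; simp), RatFunc.eval_algebraMap,
    RatFunc.eval_algebraMap] at h'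
  simpa using h'

theorem norm_one_sub_ofReal_mul {a : ℝ} {w : ℂ} (hw : ‖w‖ = 1) : ‖1 - a * w‖ = ‖w - a‖ := by
  have h1 : w * starRingEnd ℂ w = 1 := by
    rw [Complex.mul_conj, Complex.normSq_eq_norm_sq, hw]
    simp
  have h2 : w - a = w * starRingEnd ℂ (1 - a * w) := by
    simp only [map_sub, map_one, map_mul, Complex.conj_ofReal]
    linear_combination a * h1
  rw [h2, norm_mul, hw, one_mul, RCLike.norm_conj]

theorem norm_eval_blaschke {a : ℝ} (ha : |a| < 1) {w : ℂ} (hw : ‖w‖ = 1) :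
    ‖RatFunc.eval (algebraMap ℝ ℂ) w (blaschke a)‖ = 1 := by
  have hne : w - a ≠ 0 := by
    rw [sub_ne_zero]
    rintro rfl
    simp [ha.ne] at hw
  have h := congrArg norm (eval_blaschke_mul ha hw)
  rw [norm_mul, norm_one_sub_ofReal_mul hw] at h
  exact mul_eq_right₀ (norm_ne_zero_iff.2 hne) |>.1 h

/-- The solution `a = (c z - 1) / (c - z)` of `(1 - a z) / (z - a) = c` is real, and it lies in
`(-1, 1)` if `c` and `z` are in opposite half planes. -/
theorem exists_eval_blaschke_eq {z c : ℂ} (hz : ‖z‖ = 1) (hc : ‖c‖ = 1) (h : c.im * z.im < 0) :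
    ∃ a : ℝ, |a| < 1 ∧ RatFunc.eval (algebraMap ℝ ℂ) z (blaschke a) = c := by
  have hz2 : z.re * z.re + z.im * z.im = 1 := by
    rw [← Complex.normSq_apply, Complex.normSq_eq_norm_sq, hz, one_pow]
  have hc2 : c.re * c.re + c.im * c.im = 1 := by
    rw [← Complex.normSq_apply, Complex.normSq_eq_norm_sq, hc, one_pow]
  have hne : c - z ≠ 0 := by
    rw [sub_ne_zero]
    rintro rfl
    nlinarith
  have hcz : 0 < ‖c - z‖ := norm_pos_iff.2 hne
  have hconj : starRingEnd ℂ ((c * z - 1) / (c - z)) = (c * z - 1) / (c - z) := by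
    have h1 : z * starRingEnd ℂ z = 1 := by
      rw [Complex.mul_conj, Complex.normSq_eq_norm_sq, hz]
      simp
    have h2 : c * starRingEnd ℂ c = 1 := by
      rw [Complex.mul_conj, Complex.normSq_eq_norm_sq, hc]
      simp
    have hne' : starRingEnd ℂ c - starRingEnd ℂ z ≠ 0 := by
      rw [← map_sub]
      exact (map_ne_zero _).2 hne
    simp only [map_div₀, map_sub, map_one, map_mul]
    rw [div_eq_div_iff hne' hne]
    linear_combination (starRingEnd ℂ z - z) * h2 + (c - starRingEnd ℂ c) * h1
  obtain ⟨a, ha⟩ := Complex.conj_eq_iff_real.1 hconj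
  replace ha := ha.symm
  have ha1 : |a| < 1 := by
    have : |a| = ‖c * z - 1‖ / ‖c - z‖ := by
      rw [← norm_div, ← ha, Complex.norm_real, Real.norm_eq_abs]
    rw [this, div_lt_one hcz]
    refine lt_of_pow_lt_pow_left₀ 2 hcz.le ?_
    rw [← Complex.normSq_eq_norm_sq, ← Complex.normSq_eq_norm_sq, Complex.normSq_apply,
      Complex.normSq_apply]
    simp only [Complex.sub_re, Complex.mul_re, Complex.one_re, Complex.sub_im, Complex.mul_im,
      Complex.one_im]
    have e : (c.re * z.re - c.im * z.im) * (c.re * z.re - c.im * z.im) +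
      (c.re * z.im + c.im * z.re) * (c.re * z.im + c.im * z.re) = 1 := by
      linear_combination (z.re * z.re + z.im * z.im) * hc2 + hz2
    nlinarith
  refine ⟨a, ha1, ?_⟩
  have h1 := eval_blaschke_mul ha1 hz
  have hza : z - a ≠ 0 := by
    rw [sub_ne_zero]
    rintro rfl
    simp at h
  refine mul_right_cancel₀ hza (h1.trans ?_)
  rw [eq_div_iff hne] at ha
  linear_combination ha

/-- A value at a non-real point of the unit circle is interpolated by a stable proper real-rational
function of constant modulus on the circle. -/
theorem exists_interpolant {z : ℂ} (hz : ‖z‖ = 1) (hz' : z.im ≠ 0) (c : ℂ) :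
    ∃ f ∈ rhInfRing, RatFunc.eval (algebraMap ℝ ℂ) z f = c ∧
      ∀ w : ℂ, ‖w‖ = 1 → ‖RatFunc.eval (algebraMap ℝ ℂ) w f‖ = ‖c‖ := by
  have key (c : ℂ) (r : ℝ) (hc : ‖c‖ = 1) (h : c.im * z.im < 0) :
      ∃ f ∈ rhInfRing, RatFunc.eval (algebraMap ℝ ℂ) z f = r * c ∧
      ∀ w : ℂ, ‖w‖ = 1 → ‖RatFunc.eval (algebraMap ℝ ℂ) w f‖ = |r| := by
    obtain ⟨a, ha, hac⟩ := exists_eval_blaschke_eq hz hc h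
    have hmem := blaschke_mem_rhInfRing ha
    have hmul (w : ℂ) (hw : ‖w‖ = 1) : RatFunc.eval (algebraMap ℝ ℂ) w (RatFunc.C r * blaschke a) =
        r * RatFunc.eval (algebraMap ℝ ℂ) w (blaschke a) := by
      rw [RatFunc.eval_mul _ _ (by simp) (aeval_denom_ne_zero hmem hw.ge), RatFunc.eval_C]
      rfl
    refine ⟨_, mul_mem (C_mem_rhInfRing r) hmem, ?_, fun w hw => ?_⟩
    · rw [hmul z hz, hac]
    · rw [hmul w hw, norm_mul, norm_eval_blaschke ha hw, mul_one, Complex.norm_real,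
        Real.norm_eq_abs]
  rcases eq_or_ne c.im 0 with h0 | h0
  · have hc : (c.re : ℂ) = c := Complex.ext (by simp) (by simp [h0])
    refine ⟨_, C_mem_rhInfRing c.re, ?_, fun w _ => ?_⟩ <;> rw [RatFunc.eval_C]
    exacts [hc, congrArg norm hc]
  · have hc0 : c ≠ 0 := by
      rintro rfl
      simp at h0
    have hn : 0 < ‖c‖ := norm_pos_iff.2 hc0
    -- `r = ± ‖c‖`, with the sign that puts `c / r` into the half plane opposite to `z`
    obtain ⟨r, hr, hlt⟩ : ∃ r : ℝ, |r| = ‖c‖ ∧ r⁻¹ * c.im * z.im < 0 := by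
      rcases (mul_ne_zero h0 hz').lt_or_gt with hlt | hgt
      · refine ⟨‖c‖, abs_of_pos hn, ?_⟩
        rw [mul_assoc]
        exact mul_neg_of_pos_of_neg (inv_pos.2 hn) hlt
      · refine ⟨-‖c‖, by rw [abs_neg, abs_of_pos hn], ?_⟩
        rw [mul_assoc, inv_neg]
        exact mul_neg_of_neg_of_pos (neg_neg_of_pos (inv_pos.2 hn)) hgt
    have hr0 : r ≠ 0 := by
      rintro rfl
      simp [hn.ne] at hr
    obtain ⟨f, hf, hfz, hfw⟩ := key ((r : ℂ)⁻¹ * c) r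
      (by rw [norm_mul, norm_inv, Complex.norm_real, Real.norm_eq_abs, hr, inv_mul_cancel₀ hn.ne'])
      (by simpa [← Complex.ofReal_inv] using hlt)
    refine ⟨f, hf, ?_, fun w hw => (hfw w hw).trans hr⟩
    rw [hfz, mul_inv_cancel_left₀ (Complex.ofReal_ne_zero.2 hr0)]

variable {ι κ : Type} [Fintype ι] [Fintype κ] [DecidableEq κ]

open scoped Matrix.Norms.L2Operator in
theorem l2_opNorm_vecMulVec_le (a : ι → ℂ) (b : κ → ℂ) :
    ‖Matrix.vecMulVec a b‖ ≤ ‖WithLp.toLp 2 a‖ * ‖WithLp.toLp 2 b‖ := by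
  rw [Matrix.l2_opNorm_def]
  refine ContinuousLinearMap.opNorm_le_bound _ (by positivity) fun v => ?_
  have h1 : Matrix.vecMulVec a b *ᵥ v.ofLp = (b ⬝ᵥ v.ofLp) • a := by
    ext i
    simp [Matrix.mulVec, Matrix.vecMulVec_apply, dotProduct, Finset.mul_sum, mul_assoc, mul_comm]
  have h2 : ‖b ⬝ᵥ v.ofLp‖ ≤ ‖WithLp.toLp 2 b‖ * ‖v‖ := by
    have := norm_inner_le_norm (𝕜 := ℂ) (WithLp.toLp 2 (star b)) v
    rw [EuclideanSpace.inner_eq_star_dotProduct, star_star, dotProduct_comm] at this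
    simpa [EuclideanSpace.norm_eq] using this
  calc _ = ‖WithLp.toLp 2 (Matrix.vecMulVec a b *ᵥ v.ofLp)‖ := rfl
    _ = ‖b ⬝ᵥ v.ofLp‖ * ‖WithLp.toLp 2 a‖ := by rw [h1, WithLp.toLp_smul, norm_smul]
    _ ≤ _ := by nlinarith [norm_nonneg (WithLp.toLp 2 a)]

open scoped Matrix.Norms.L2Operator in
/-- Every rank-one matrix is the value at a given non-real point of the unit circle of some
rank-one `RH_∞` matrix whose norm on the whole circle is not larger. -/
theorem exists_rankOne_interpolant {z : ℂ} (hz : ‖z‖ = 1) (hz' : z.im ≠ 0)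
    (x : ι → ℂ) (y : κ → ℂ) :
    ∃ δ : TransferMatrix ι κ, IsRHInf δ ∧ evalAt z δ = Matrix.vecMulVec x y ∧
      ∀ w : ℂ, ‖w‖ = 1 → ‖evalAt w δ‖ ≤ ‖WithLp.toLp 2 x‖ * ‖WithLp.toLp 2 y‖ := by
  choose f hf hfz hfw using fun i => exists_interpolant hz hz' (x i)
  choose g hg hgz hgw using fun j => exists_interpolant hz hz' (y j)
  have heval (w : ℂ) (hw : ‖w‖ = 1) : evalAt w (Matrix.vecMulVec f g) = Matrix.vecMulVec
      (fun i => RatFunc.eval (algebraMap ℝ ℂ) w (f i))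
      (fun j => RatFunc.eval (algebraMap ℝ ℂ) w (g j)) := by
    ext i j
    simp only [evalAt, Matrix.map_apply, Matrix.vecMulVec_apply]
    exact RatFunc.eval_mul _ _ (aeval_denom_ne_zero (hf i) hw.ge)
      (aeval_denom_ne_zero (hg j) hw.ge)
  refine ⟨Matrix.vecMulVec f g, fun i j => rhInfRing.mul_mem (hf i) (hg j), ?_, fun w hw => ?_⟩
  · rw [heval z hz]
    simp only [hfz, hgz]
  · rw [heval w hw]
    refine (l2_opNorm_vecMulVec_le _ _).trans (le_of_eq ?_)
    simp only [EuclideanSpace.norm_eq, hfw _ w hw, hgw _ w hw]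

end Interpolation

/-! ### The `H_∞` norm -/

section Norm

variable {ι κ μ : Type} [Fintype ι] [Fintype κ] [DecidableEq κ]

open scoped Matrix.Norms.L2Operator in
theorem hInfNorm_le_ofReal {G : TransferMatrix ι κ} {c : ℝ} (hc : 0 ≤ c) :
    hInfNorm G ≤ ENNReal.ofReal c ↔ ∀ w : ℂ, ‖w‖ = 1 → ‖evalAt w G‖ ≤ c := by
  rw [hInfNorm, iSup_le_iff]
  refine ⟨fun h w hw => ?_, fun h w => ?_⟩
  · have := h ⟨w, by simp [hw]⟩
    rwa [← ofReal_norm, ENNReal.ofReal_le_ofReal_iff hc] at this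
  · rw [← ofReal_norm]
    exact ENNReal.ofReal_le_ofReal (h w (by simp))

open scoped Matrix.Norms.L2Operator in
theorem hInfNorm_lt_ofReal {G : TransferMatrix ι κ} {ε : ℝ} (hε : 0 < ε) :
    hInfNorm G < ENNReal.ofReal ε ↔
      ∃ c, 0 ≤ c ∧ c < ε ∧ ∀ w : ℂ, ‖w‖ = 1 → ‖evalAt w G‖ ≤ c := by
  constructor
  · intro h
    refine ⟨(hInfNorm G).toReal, ENNReal.toReal_nonneg, ?_, ?_⟩
    · exact ENNReal.toReal_lt_of_lt_ofReal h
    · rw [← hInfNorm_le_ofReal ENNReal.toReal_nonneg, ENNReal.ofReal_toReal h.ne_top]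
  · rintro ⟨c, hc, hlt, h⟩
    exact ((hInfNorm_le_ofReal hc).2 h).trans_lt ((ENNReal.ofReal_lt_ofReal_iff hε).2 hlt)

theorem hInfNorm_zero : hInfNorm (0 : TransferMatrix ι κ) = 0 := by
  simp [hInfNorm, evalAt_zero]

omit [Fintype ι] [Fintype κ] [DecidableEq κ] in
theorem continuous_evalAt_exp {G : TransferMatrix ι κ} (hG : IsRHInf G) :
    Continuous fun t : ℝ => evalAt (Complex.exp (t * Complex.I)) G := by
  refine continuous_pi fun i => continuous_pi fun j => ?_
  have he : Continuous fun t : ℝ => Complex.exp (t * Complex.I) := by fun_prop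
  refine Continuous.div ?_ ?_ fun t =>
    aeval_denom_ne_zero (hG i j) (Complex.norm_exp_ofReal_mul_I t).ge
  · exact ((G i j).num.continuous_aeval (A := ℂ)).comp he
  · exact ((G i j).denom.continuous_aeval (A := ℂ)).comp he

open scoped Matrix.Norms.L2Operator in
/-- A norm bound on the circle needs to be checked at non-real points only. -/
theorem norm_evalAt_le_of_im_ne_zero {G : TransferMatrix ι κ} (hG : IsRHInf G) {c : ℝ}
    (h : ∀ w : ℂ, ‖w‖ = 1 → w.im ≠ 0 → ‖evalAt w G‖ ≤ c) (w : ℂ) (hw : ‖w‖ = 1) :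
    ‖evalAt w G‖ ≤ c := by
  have hcl : IsClosed {t : ℝ | ‖evalAt (Complex.exp (t * Complex.I)) G‖ ≤ c} :=
    isClosed_le (continuous_norm.comp (continuous_evalAt_exp hG)) continuous_const
  have hd : Dense {t : ℝ | Real.sin t = 0}ᶜ := by
    refine Set.Countable.dense_compl ℝ ?_
    refine (Set.countable_range fun k : ℤ => k * Real.pi).mono ?_
    intro t ht
    exact Real.sin_eq_zero_iff.1 ht
  have hall : ∀ t : ℝ, ‖evalAt (Complex.exp (t * Complex.I)) G‖ ≤ c := by
    intro t
    refine closure_minimal (s := {t : ℝ | Real.sin t = 0}ᶜ) ?_ hcl (hd t)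
    intro s hs
    refine h _ (Complex.norm_exp_ofReal_mul_I s) ?_
    rwa [Complex.exp_ofReal_mul_I_im]
  have := hall w.arg
  rwa [← one_mul (Complex.exp _), ← Complex.ofReal_one, ← hw, Complex.norm_mul_exp_arg_mul_I]
    at this

open scoped Matrix.Norms.L2Operator in
/-- Sharpness of the small gain theorem: if `Φ` has norm larger than `1 / ε` at a non-real point
`z` of the unit circle, then a stable `δ` of norm less than `ε` makes `1 - δ Φ` singular at `z`. -/
theorem exists_destabilizing [DecidableEq ι] {Φ : TransferMatrix κ ι} (hΦ : IsRHInf Φ) {z : ℂ}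
    (hz : ‖z‖ = 1) (hz' : z.im ≠ 0) {ε : ℝ} (hε : 0 < ε) (h : ε⁻¹ < ‖evalAt z Φ‖) :
    ∃ δ : TransferMatrix ι κ, IsRHInf δ ∧
      (∃ c, 0 ≤ c ∧ c < ε ∧ ∀ w : ℂ, ‖w‖ = 1 → ‖evalAt w δ‖ ≤ c) ∧
      ∃ x ≠ 0, evalAt z (1 - δ * Φ) *ᵥ x = 0 := by
  obtain ⟨x, hx⟩ : ∃ x : EuclideanSpace ℂ ι,
      ε⁻¹ * ‖x‖ < ‖WithLp.toLp 2 (evalAt z Φ *ᵥ x.ofLp)‖ := by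
    by_contra! hle
    refine h.not_ge ?_
    rw [Matrix.l2_opNorm_def]
    exact ContinuousLinearMap.opNorm_le_bound _ (by positivity) hle
  set y := evalAt z Φ *ᵥ x.ofLp with hy
  have hy0 : 0 < ‖WithLp.toLp 2 y‖ := lt_of_le_of_lt (by positivity) hx
  have hyy : star y ⬝ᵥ y = (‖WithLp.toLp 2 y‖ : ℂ) ^ 2 := by
    rw [dotProduct_comm, ← EuclideanSpace.inner_toLp_toLp, inner_self_eq_norm_sq_to_K]
    rfl
  have hystar : ‖WithLp.toLp 2 (star y)‖ = ‖WithLp.toLp 2 y‖ := by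
    simp [EuclideanSpace.norm_eq]
  obtain ⟨δ, hδ, hδz, hδw⟩ := exists_rankOne_interpolant hz hz'
    (((‖WithLp.toLp 2 y‖ : ℂ) ^ 2)⁻¹ • x.ofLp) (star y)
  refine ⟨δ, hδ, ⟨_, by positivity, ?_, hδw⟩, x.ofLp, ?_, ?_⟩
  · have : ‖WithLp.toLp 2 ((((‖WithLp.toLp 2 y‖ : ℂ) ^ 2)⁻¹ • x.ofLp))‖ =
        (‖WithLp.toLp 2 y‖ ^ 2)⁻¹ * ‖x‖ := by
      rw [WithLp.toLp_smul, norm_smul, norm_inv, norm_pow, Complex.norm_real, norm_norm]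
    rw [this, hystar]
    have h1 : ‖x‖ < ε * ‖WithLp.toLp 2 y‖ := (inv_mul_lt_iff₀ hε).1 hx
    have h2 : (‖WithLp.toLp 2 y‖ ^ 2)⁻¹ * ‖x‖ * ‖WithLp.toLp 2 y‖ = ‖x‖ / ‖WithLp.toLp 2 y‖ := by
      field_simp
    rw [h2, div_lt_iff₀ hy0]
    exact h1
  · intro h0
    rw [hy, h0] at hy0
    simp at hy0
  · rw [evalAt_sub hz.ge (isRHInf_iff.2 entriesIn_one) (isRHInf_iff.2 (EntriesIn.mul hδ hΦ)),
      evalAt_mul hz.ge hδ hΦ, evalAt_one, hδz, Matrix.sub_mulVec, Matrix.one_mulVec,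
      ← Matrix.mulVec_mulVec, ← hy]
    ext i
    have hy1 : (‖WithLp.toLp 2 y‖ : ℂ) ^ 2 ≠ 0 := by
      simpa using hy0.ne'
    have : (Matrix.vecMulVec (((‖WithLp.toLp 2 y‖ : ℂ) ^ 2)⁻¹ • x.ofLp) (star y) *ᵥ y) i =
        ((‖WithLp.toLp 2 y‖ : ℂ) ^ 2)⁻¹ * x.ofLp i * (star y ⬝ᵥ y) := by
      simp only [Matrix.mulVec, Matrix.vecMulVec_apply, dotProduct, Finset.mul_sum, Pi.smul_apply,
        smul_eq_mul, mul_assoc]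
    rw [Pi.sub_apply, this, hyy]
    rw [mul_right_comm, inv_mul_cancel₀ hy1, one_mul, sub_self]
    rfl

end Norm

/-! ### Selection of signals -/

section Selector

variable {ι κ ι' κ' : Type} [DecidableEq ι] [DecidableEq κ]

/-- The `0`-`1` matrix that embeds `ι`-indexed signals into `κ`-indexed ones along `f`. -/
def selector (R : Type) [Zero R] [One R] (f : ι → κ) : Matrix κ ι R :=
  (1 : Matrix κ κ R).submatrix id f

omit [DecidableEq ι] in
theorem transpose_selector_mul_mul_selector {R : Type} [NonAssocSemiring R] [DecidableEq κ']
    [Fintype κ] [Fintype κ'] (f : ι → κ) (g : ι' → κ') (M : Matrix κ κ' R) :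
    (selector R f)ᵀ * M * selector R g = M.submatrix f g := by
  ext i j
  simp [selector, Matrix.mul_apply, Matrix.one_apply]

theorem transpose_selector_mul_selector {R : Type} [NonAssocSemiring R] [Fintype κ] {f : ι → κ}
    (hf : Function.Injective f) : (selector R f)ᵀ * selector R f = 1 := by
  ext i j
  simp [selector, Matrix.mul_apply, Matrix.one_apply, hf.eq_iff]

omit [DecidableEq ι] in
theorem isRHInf_selector (f : ι → κ) : IsRHInf (selector (RatFunc ℝ) f) :=
  fun i j => (entriesIn_one (R := rhInfRing)) i (f j)

omit [DecidableEq ι] in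
theorem evalAt_selector (w : ℂ) (f : ι → κ) :
    evalAt w (selector (RatFunc ℝ) f) = selector ℂ f := by
  ext i j
  simp [evalAt, selector, Matrix.one_apply, apply_ite]

open scoped Matrix.Norms.L2Operator in
theorem norm_selector_le_one [Fintype ι] [Fintype κ] {f : ι → κ} (hf : Function.Injective f) :
    ‖selector ℂ f‖ ≤ 1 := by
  have h1 : (selector ℂ f)ᴴ * selector ℂ f = 1 := by
    rw [← transpose_selector_mul_selector hf]
    congr 1
    ext i j
    simp [selector, Matrix.one_apply, apply_ite]
  have h2 := Matrix.l2_opNorm_conjTranspose_mul_self (selector ℂ f)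
  rw [h1] at h2
  have h3 : ‖(1 : Matrix ι ι ℂ)‖ ≤ 1 := by
    rw [← Matrix.diagonal_one, Matrix.l2_opNorm_diagonal]
    exact pi_norm_le_iff_of_nonneg zero_le_one |>.2 fun i => by simp
  nlinarith [norm_nonneg (selector ℂ f)]

open scoped Matrix.Norms.L2Operator in
theorem norm_transpose_selector_le_one [Fintype ι] [Fintype κ] {f : ι → κ}
    (hf : Function.Injective f) : ‖(selector ℂ f)ᵀ‖ ≤ 1 := by
  have : (selector ℂ f)ᵀ = (selector ℂ f)ᴴ := by
    ext i j
    simp [selector, Matrix.one_apply, apply_ite]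
  rw [this, Matrix.l2_opNorm_conjTranspose]
  exact norm_selector_le_one hf

omit [DecidableEq ι] in
open scoped Matrix.Norms.L2Operator in
theorem norm_mul_mul_le_of_le_one [Fintype ι] [Fintype κ] [Fintype ι'] [Fintype κ']
    [DecidableEq ι'] [DecidableEq κ'] {P : Matrix ι κ ℂ} {N : Matrix κ κ' ℂ} {Q : Matrix κ' ι' ℂ}
    (hP : ‖P‖ ≤ 1) (hQ : ‖Q‖ ≤ 1) : ‖P * N * Q‖ ≤ ‖N‖ := by
  calc ‖P * N * Q‖ ≤ ‖P‖ * ‖N‖ * ‖Q‖ :=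
        (Matrix.l2_opNorm_mul _ _).trans (by gcongr; exact Matrix.l2_opNorm_mul _ _)
    _ ≤ 1 * ‖N‖ * 1 := by gcongr
    _ = ‖N‖ := by ring

end Selector

/-! ### Feedback perturbations of an invertible matrix -/

section Loop

variable {R η α β : Type} [CommRing R] [Fintype η] [Fintype α] [Fintype β]
  [DecidableEq η] [DecidableEq α] [DecidableEq β]
  {M S : Matrix η η R} {E : Matrix η α R} {F : Matrix β η R} {δ : Matrix α β R}

omit [DecidableEq α] in
/-- If `1 - Φ δ`, with `Φ = F S E`, has the inverse `T`, then `S + S E δ T F S` inverts the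
perturbed matrix. -/
theorem sub_mul_eq_one_of_mul_eq_one (hMS : M * S = 1) {T : Matrix β β R}
    (hT : (1 - F * S * E * δ) * T = 1) :
    (M - E * δ * F) * (S + S * E * δ * T * F * S) = 1 := by
  have hT' : T = 1 + F * S * E * δ * T := by
    rw [Matrix.sub_mul, Matrix.one_mul, sub_eq_iff_eq_add] at hT
    exact hT
  have h1 : M * (S * E * δ * T * F * S) = E * δ * T * F * S := by
    simp only [← Matrix.mul_assoc, hMS, Matrix.one_mul]
  have h2 : E * δ * T * F * S = E * δ * F * S + E * δ * F * (S * E * δ * T * F * S) := by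
    conv_lhs => rw [hT']
    simp only [Matrix.mul_add, Matrix.add_mul, Matrix.mul_one, ← Matrix.mul_assoc]
  rw [Matrix.sub_mul, Matrix.mul_add, Matrix.mul_add, hMS, h1, ← h2, add_sub_cancel_right]

omit [DecidableEq β] in
/-- If the perturbed matrix has the inverse `S'`, then `1 + δ (F S' E)` inverts `1 - δ (F S E)`. -/
theorem one_add_mul_one_sub_eq_one (hMS : M * S = 1) {S' : Matrix η η R}
    (hS' : S' * (M - E * δ * F) = 1) :
    (1 + δ * (F * S' * E)) * (1 - δ * (F * S * E)) = 1 := by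
  have h1 : S' = S + S' * E * δ * F * S := by
    have := congrArg (· * S) hS'
    simp only [Matrix.mul_sub, Matrix.sub_mul, Matrix.one_mul, Matrix.mul_assoc, hMS,
      Matrix.mul_one] at this
    rw [sub_eq_iff_eq_add] at this
    simpa only [Matrix.mul_assoc] using this
  have h2 : F * S' * E = F * S * E + F * S' * E * (δ * (F * S * E)) := by
    conv_lhs => rw [h1]
    simp only [Matrix.mul_add, Matrix.add_mul, Matrix.mul_assoc]
  have h3 : δ * (F * S' * E) = δ * (F * S * E) + δ * (F * S' * E) * (δ * (F * S * E)) := by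
    conv_lhs => rw [h2]
    simp only [Matrix.mul_add, Matrix.mul_assoc]
  generalize δ * (F * S' * E) = a at h3 ⊢
  generalize δ * (F * S * E) = b at h3 ⊢
  have h4 : (1 + a) * (1 - b) = 1 + (a - (b + a * b)) := by noncomm_ring
  rw [h4, ← h3, sub_self, add_zero]

end Loop

/-! ### Block matrices on `(x, u, y)` -/

section Blocks

variable {n m p : ℕ}

theorem blocks₃_mul
    (Axx : TransferMatrix (Fin n) (Fin n)) (Axu : TransferMatrix (Fin n) (Fin m))
    (Axy : TransferMatrix (Fin n) (Fin p))
    (Aux : TransferMatrix (Fin m) (Fin n)) (Auu : TransferMatrix (Fin m) (Fin m))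
    (Auy : TransferMatrix (Fin m) (Fin p))
    (Ayx : TransferMatrix (Fin p) (Fin n)) (Ayu : TransferMatrix (Fin p) (Fin m))
    (Ayy : TransferMatrix (Fin p) (Fin p))
    (Bxx : TransferMatrix (Fin n) (Fin n)) (Bxu : TransferMatrix (Fin n) (Fin m))
    (Bxy : TransferMatrix (Fin n) (Fin p))
    (Bux : TransferMatrix (Fin m) (Fin n)) (Buu : TransferMatrix (Fin m) (Fin m))
    (Buy : TransferMatrix (Fin m) (Fin p))
    (Byx : TransferMatrix (Fin p) (Fin n)) (Byu : TransferMatrix (Fin p) (Fin m))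
    (Byy : TransferMatrix (Fin p) (Fin p)) :
    blocks₃ Axx Axu Axy Aux Auu Auy Ayx Ayu Ayy * blocks₃ Bxx Bxu Bxy Bux Buu Buy Byx Byu Byy =
      blocks₃ (Axx * Bxx + (Axu * Bux + Axy * Byx)) (Axx * Bxu + (Axu * Buu + Axy * Byu))
        (Axx * Bxy + (Axu * Buy + Axy * Byy))
        (Aux * Bxx + (Auu * Bux + Auy * Byx)) (Aux * Bxu + (Auu * Buu + Auy * Byu))
        (Aux * Bxy + (Auu * Buy + Auy * Byy))
        (Ayx * Bxx + (Ayu * Bux + Ayy * Byx)) (Ayx * Bxu + (Ayu * Buu + Ayy * Byu))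
        (Ayx * Bxy + (Ayu * Buy + Ayy * Byy)) := by
  ext (i | i | i) (j | j | j) <;> simp [blocks₃, Matrix.mul_apply, Fintype.sum_sum_type]

theorem blocks₃_eq_one_iff
    {Axx : TransferMatrix (Fin n) (Fin n)} {Axu : TransferMatrix (Fin n) (Fin m)}
    {Axy : TransferMatrix (Fin n) (Fin p)}
    {Aux : TransferMatrix (Fin m) (Fin n)} {Auu : TransferMatrix (Fin m) (Fin m)}
    {Auy : TransferMatrix (Fin m) (Fin p)}
    {Ayx : TransferMatrix (Fin p) (Fin n)} {Ayu : TransferMatrix (Fin p) (Fin m)}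
    {Ayy : TransferMatrix (Fin p) (Fin p)} :
    blocks₃ Axx Axu Axy Aux Auu Auy Ayx Ayu Ayy = 1 ↔
      (Axx = 1 ∧ Axu = 0 ∧ Axy = 0) ∧ (Aux = 0 ∧ Auu = 1 ∧ Auy = 0) ∧
        (Ayx = 0 ∧ Ayu = 0 ∧ Ayy = 1) := by
  have h1 : (1 : TransferMatrix (Fin n ⊕ Fin m ⊕ Fin p) (Fin n ⊕ Fin m ⊕ Fin p)) =
      blocks₃ 1 0 0 0 1 0 0 0 1 := by
    ext (i | i | i) (j | j | j) <;> simp [blocks₃, Matrix.one_apply]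
  rw [h1, blocks₃, blocks₃, Matrix.fromRows_inj.eq_iff, Matrix.fromCols_inj.eq_iff,
    Matrix.fromCols_inj.eq_iff, Matrix.fromRows_inj.eq_iff, Matrix.fromCols_inj.eq_iff,
    Matrix.fromCols_inj.eq_iff, Matrix.fromCols_inj.eq_iff, Matrix.fromCols_inj.eq_iff]

theorem exists_eq_blocks₃
    (S : TransferMatrix (Fin n ⊕ Fin m ⊕ Fin p) (Fin n ⊕ Fin m ⊕ Fin p)) :
    ∃ Sxx Sxu Sxy Sux Suu Suy Syx Syu Syy, S = blocks₃ Sxx Sxu Sxy Sux Suu Suy Syx Syu Syy := by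
  refine ⟨S.toRows₁.toCols₁, S.toRows₁.toCols₂.toCols₁, S.toRows₁.toCols₂.toCols₂,
    S.toRows₂.toRows₁.toCols₁, S.toRows₂.toRows₁.toCols₂.toCols₁,
    S.toRows₂.toRows₁.toCols₂.toCols₂, S.toRows₂.toRows₂.toCols₁,
    S.toRows₂.toRows₂.toCols₂.toCols₁, S.toRows₂.toRows₂.toCols₂.toCols₂, ?_⟩
  simp [blocks₃]

theorem entriesIn_blocks₃ {R : Subring (RatFunc ℝ)}
    {Axx : TransferMatrix (Fin n) (Fin n)} {Axu : TransferMatrix (Fin n) (Fin m)}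
    {Axy : TransferMatrix (Fin n) (Fin p)}
    {Aux : TransferMatrix (Fin m) (Fin n)} {Auu : TransferMatrix (Fin m) (Fin m)}
    {Auy : TransferMatrix (Fin m) (Fin p)}
    {Ayx : TransferMatrix (Fin p) (Fin n)} {Ayu : TransferMatrix (Fin p) (Fin m)}
    {Ayy : TransferMatrix (Fin p) (Fin p)} :
    EntriesIn R (blocks₃ Axx Axu Axy Aux Auu Auy Ayx Ayu Ayy) ↔
      (EntriesIn R Axx ∧ EntriesIn R Axu ∧ EntriesIn R Axy) ∧
        (EntriesIn R Aux ∧ EntriesIn R Auu ∧ EntriesIn R Auy) ∧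
        (EntriesIn R Ayx ∧ EntriesIn R Ayu ∧ EntriesIn R Ayy) := by
  simp only [EntriesIn, blocks₃, Sum.forall, Matrix.fromRows_apply_inl, Matrix.fromRows_apply_inr,
    Matrix.fromCols_apply_inl, Matrix.fromCols_apply_inr, forall_and]
  tauto

theorem one_sub_realization
    (A : TransferMatrix (Fin n) (Fin n)) (B : TransferMatrix (Fin n) (Fin m))
    (C : TransferMatrix (Fin p) (Fin n)) (D : TransferMatrix (Fin p) (Fin m))
    (K : TransferMatrix (Fin m) (Fin p)) :
    1 - realization A B C D K =
      blocks₃ ((RatFunc.X : RatFunc ℝ) • 1 - A) (-B) 0 0 1 (-K) (-C) (-D) 1 := by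
  ext (i | i | i) (j | j | j) <;> simp [realization, blocks₃, Matrix.one_apply]

theorem realization_add
    (A ΔA : TransferMatrix (Fin n) (Fin n)) (B ΔB : TransferMatrix (Fin n) (Fin m))
    (C ΔC : TransferMatrix (Fin p) (Fin n)) (D ΔD : TransferMatrix (Fin p) (Fin m))
    (K : TransferMatrix (Fin m) (Fin p)) :
    realization (A + ΔA) (B + ΔB) (C + ΔC) (D + ΔD) K =
      realization A B C D K + structuredPerturbation ΔA ΔB ΔC ΔD := by
  ext (i | i | i) (j | j | j) <;> simp [realization, structuredPerturbation, blocks₃]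
  ring

/-- The places of the signals `(x, u)` among `(x, u, y)`. -/
def xuIndex (n m p : ℕ) : Fin n ⊕ Fin m → Fin n ⊕ Fin m ⊕ Fin p := Sum.map id Sum.inl

/-- The places of the signals `(x, y)` among `(x, u, y)`. -/
def xyIndex (n m p : ℕ) : Fin n ⊕ Fin p → Fin n ⊕ Fin m ⊕ Fin p := Sum.map id Sum.inr

theorem xuIndex_injective : Function.Injective (xuIndex n m p) :=
  Sum.map_injective.2 ⟨Function.injective_id, Sum.inl_injective⟩

theorem xyIndex_injective : Function.Injective (xyIndex n m p) :=
  Sum.map_injective.2 ⟨Function.injective_id, Sum.inr_injective⟩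

theorem structuredPerturbation_eq
    (ΔA : TransferMatrix (Fin n) (Fin n)) (ΔB : TransferMatrix (Fin n) (Fin m))
    (ΔC : TransferMatrix (Fin p) (Fin n)) (ΔD : TransferMatrix (Fin p) (Fin m)) :
    structuredPerturbation ΔA ΔB ΔC ΔD = selector (RatFunc ℝ) (xyIndex n m p) *
      Matrix.fromBlocks ΔA ΔB ΔC ΔD * (selector (RatFunc ℝ) (xuIndex n m p))ᵀ := by
  ext (i | i | i) (j | j | j) <;>
    simp [structuredPerturbation, blocks₃, selector, xuIndex, xyIndex, Matrix.mul_apply,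
      Fintype.sum_sum_type, Matrix.one_apply]

theorem isRHInf_fromBlocks
    {ΔA : TransferMatrix (Fin n) (Fin n)} {ΔB : TransferMatrix (Fin n) (Fin m)}
    {ΔC : TransferMatrix (Fin p) (Fin n)} {ΔD : TransferMatrix (Fin p) (Fin m)} :
    IsRHInf (Matrix.fromBlocks ΔA ΔB ΔC ΔD) ↔
      (IsRHInf ΔA ∧ IsRHInf ΔB) ∧ (IsRHInf ΔC ∧ IsRHInf ΔD) := by
  simp only [IsRHInf, Sum.forall, Matrix.fromBlocks_apply₁₁, Matrix.fromBlocks_apply₁₂,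
    Matrix.fromBlocks_apply₂₁, Matrix.fromBlocks_apply₂₂, forall_and]
  tauto

open scoped Matrix.Norms.L2Operator in
theorem norm_evalAt_structuredPerturbation
    {ΔA : TransferMatrix (Fin n) (Fin n)} {ΔB : TransferMatrix (Fin n) (Fin m)}
    {ΔC : TransferMatrix (Fin p) (Fin n)} {ΔD : TransferMatrix (Fin p) (Fin m)}
    (hA : IsRHInf ΔA) (hB : IsRHInf ΔB) (hC : IsRHInf ΔC) (hD : IsRHInf ΔD) {w : ℂ}
    (hw : ‖w‖ = 1) : ‖evalAt w (structuredPerturbation ΔA ΔB ΔC ΔD)‖ =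
      ‖evalAt w (Matrix.fromBlocks ΔA ΔB ΔC ΔD)‖ := by
  have hδ := isRHInf_fromBlocks.2 ⟨⟨hA, hB⟩, hC, hD⟩
  have hE := isRHInf_selector (xyIndex n m p)
  have hF : IsRHInf (selector (RatFunc ℝ) (xuIndex n m p))ᵀ :=
    fun i j => isRHInf_selector (xuIndex n m p) j i
  have h : evalAt w (structuredPerturbation ΔA ΔB ΔC ΔD) = selector ℂ (xyIndex n m p) *
      evalAt w (Matrix.fromBlocks ΔA ΔB ΔC ΔD) * (selector ℂ (xuIndex n m p))ᵀ := by
    rw [structuredPerturbation_eq, evalAt_mul hw.ge (isRHInf_iff.2 (EntriesIn.mul hE hδ)) hF,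
      evalAt_mul hw.ge hE hδ, evalAt_selector, ← evalAt_selector w (xuIndex n m p)]
    rfl
  apply le_antisymm
  · rw [h]
    exact norm_mul_mul_le_of_le_one (norm_selector_le_one xyIndex_injective)
      (norm_transpose_selector_le_one xuIndex_injective)
  · have h' : evalAt w (Matrix.fromBlocks ΔA ΔB ΔC ΔD) = (selector ℂ (xyIndex n m p))ᵀ *
        evalAt w (structuredPerturbation ΔA ΔB ΔC ΔD) * selector ℂ (xuIndex n m p) := by
      rw [transpose_selector_mul_mul_selector]
      ext (i | i) (j | j) <;> rfl
    rw [h']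
    exact norm_mul_mul_le_of_le_one (norm_transpose_selector_le_one xyIndex_injective)
      (norm_selector_le_one xuIndex_injective)

end Blocks

/-! ### The small gain condition for the perturbed loop -/

section RobustStability

variable {n m p : ℕ} {A : TransferMatrix (Fin n) (Fin n)} {B : TransferMatrix (Fin n) (Fin m)}
  {C : TransferMatrix (Fin p) (Fin n)} {D : TransferMatrix (Fin p) (Fin m)}
  {K : TransferMatrix (Fin m) (Fin p)}
  {S : TransferMatrix (Fin n ⊕ Fin m ⊕ Fin p) (Fin n ⊕ Fin m ⊕ Fin p)}

open scoped Matrix.Norms.L2Operator in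
/-- Sufficiency of the norm bound for robust stability. -/
theorem internallyStabilizes_add_of_norm_le (hMS : (1 - realization A B C D K) * S = 1)
    (hS : IsRHInf S) {ε : ℝ} (hε : 0 < ε)
    (hΦ : ∀ w : ℂ, ‖w‖ = 1 → ‖evalAt w (S.submatrix (xuIndex n m p) (xyIndex n m p))‖ ≤ ε⁻¹)
    {ΔA : TransferMatrix (Fin n) (Fin n)} {ΔB : TransferMatrix (Fin n) (Fin m)}
    {ΔC : TransferMatrix (Fin p) (Fin n)} {ΔD : TransferMatrix (Fin p) (Fin m)}
    (hA : IsRHInf ΔA) (hB : IsRHInf ΔB) (hC : IsRHInf ΔC) (hD : IsRHInf ΔD)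
    (hΔ : hInfNorm (structuredPerturbation ΔA ΔB ΔC ΔD) < ENNReal.ofReal ε) :
    InternallyStabilizes (A + ΔA) (B + ΔB) (C + ΔC) (D + ΔD) K := by
  obtain ⟨c, hc0, hcε, hc⟩ := (hInfNorm_lt_ofReal hε).1 hΔ
  have hδ := isRHInf_fromBlocks.2 ⟨⟨hA, hB⟩, hC, hD⟩
  have hΦS : IsRHInf (S.submatrix (xuIndex n m p) (xyIndex n m p)) := fun i j => hS _ _
  have hE := isRHInf_selector (xyIndex n m p)
  have hF : IsRHInf (selector (RatFunc ℝ) (xuIndex n m p))ᵀ :=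
    fun i j => isRHInf_selector (xuIndex n m p) j i
  obtain ⟨hu, hT⟩ := isUnit_one_sub_of_norm_le (c := ε⁻¹ * c)
    (isRHInf_iff.2 (EntriesIn.mul hΦS hδ))
    (by rw [inv_mul_lt_iff₀ hε, mul_one]; exact hcε) fun w hw => by
      rw [evalAt_mul hw.ge hΦS hδ]
      refine (Matrix.l2_opNorm_mul _ _).trans ?_
      have h2 := hc w hw
      rw [norm_evalAt_structuredPerturbation hA hB hC hD hw] at h2
      exact mul_le_mul (hΦ w hw) h2 (norm_nonneg _) (inv_pos.2 hε).le
  have hTinv := Matrix.mul_nonsing_inv _ ((Matrix.isUnit_iff_isUnit_det _).1 hu)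
  have key := sub_mul_eq_one_of_mul_eq_one hMS (E := selector (RatFunc ℝ) (xyIndex n m p))
    (F := (selector (RatFunc ℝ) (xuIndex n m p))ᵀ) (δ := Matrix.fromBlocks ΔA ΔB ΔC ΔD)
    (by rw [transpose_selector_mul_mul_selector]; exact hTinv)
  rw [← structuredPerturbation_eq, sub_sub, ← realization_add] at key
  refine ⟨_, key, mul_eq_one_comm.1 key, ?_⟩
  exact EntriesIn.add (R := rhInfRing) hS (((((EntriesIn.mul (R := rhInfRing) hS hE).mul hδ).mul hT).mul hF).mul hS)

open scoped Matrix.Norms.L2Operator in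
/-- Necessity of the norm bound for robust stability. -/
theorem norm_le_of_internallyStabilizes_add (hMS : (1 - realization A B C D K) * S = 1)
    (hS : IsRHInf S) {ε : ℝ} (hε : 0 < ε)
    (h : ∀ (ΔA : TransferMatrix (Fin n) (Fin n)) (ΔB : TransferMatrix (Fin n) (Fin m))
      (ΔC : TransferMatrix (Fin p) (Fin n)) (ΔD : TransferMatrix (Fin p) (Fin m)),
      IsRHInf ΔA → IsRHInf ΔB → IsRHInf ΔC → IsRHInf ΔD →
      hInfNorm (structuredPerturbation ΔA ΔB ΔC ΔD) < ENNReal.ofReal ε →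
      InternallyStabilizes (A + ΔA) (B + ΔB) (C + ΔC) (D + ΔD) K)
    (w : ℂ) (hw : ‖w‖ = 1) :
    ‖evalAt w (S.submatrix (xuIndex n m p) (xyIndex n m p))‖ ≤ ε⁻¹ := by
  have hΦS : IsRHInf (S.submatrix (xuIndex n m p) (xyIndex n m p)) := fun i j => hS _ _
  refine norm_evalAt_le_of_im_ne_zero hΦS (fun z hz hz' => ?_) w hw
  by_contra! hlt
  obtain ⟨δ, hδ, ⟨c, hc0, hcε, hc⟩, x, hx0, hx⟩ := exists_destabilizing hΦS hz hz' hε hlt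
  obtain ⟨⟨hA, hB⟩, hC, hD⟩ := isRHInf_fromBlocks.1 ((Matrix.fromBlocks_toBlocks δ).symm ▸ hδ)
  obtain ⟨S', -, hS'M, hS'⟩ := h _ _ _ _ hA hB hC hD ((hInfNorm_lt_ofReal hε).2
    ⟨c, hc0, hcε, fun v hv => by
      rw [norm_evalAt_structuredPerturbation hA hB hC hD hv, Matrix.fromBlocks_toBlocks]
      exact hc v hv⟩)
  rw [realization_add, ← sub_sub, structuredPerturbation_eq, Matrix.fromBlocks_toBlocks] at hS'M
  have key := one_add_mul_one_sub_eq_one hMS hS'M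
  rw [transpose_selector_mul_mul_selector, transpose_selector_mul_mul_selector] at key
  have hΦS' : IsRHInf (S'.submatrix (xuIndex n m p) (xyIndex n m p)) := fun i j => hS' _ _
  -- the perturbed response is analytic at `z`, so `1 - δ Φ` cannot be singular there
  have hz1 := congrArg (evalAt z) key
  rw [evalAt_mul hz.ge (isRHInf_iff.2 (entriesIn_one.add (EntriesIn.mul hδ hΦS')))
    (isRHInf_iff.2 (entriesIn_one.sub (EntriesIn.mul hδ hΦS))), evalAt_one] at hz1
  have := congrArg (· *ᵥ x) hz1
  simp only [← Matrix.mulVec_mulVec, hx, Matrix.mulVec_zero, Matrix.one_mulVec] at this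
  exact hx0 this.symm

end RobustStability

/-! ### System level parameters and the nominal loop -/

section Nominal

variable {n m p : ℕ} {A : Matrix (Fin n) (Fin n) ℝ} {B : Matrix (Fin n) (Fin m) ℝ}
  {C : Matrix (Fin p) (Fin n) ℝ} {D : Matrix (Fin p) (Fin m) ℝ}
  {K : TransferMatrix (Fin m) (Fin p)} {Φ : SLP n m p}

theorem isZInvRHInf_iff {ι κ : Type} {G : TransferMatrix ι κ} :
    IsZInvRHInf G ↔ IsRHInf ((RatFunc.X : RatFunc ℝ) • G) := by
  constructor
  · rintro ⟨H, hH, rfl⟩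
    rwa [smul_smul, mul_inv_cancel₀ RatFunc.X_ne_zero, one_smul]
  · intro h
    exact ⟨_, h, by rw [smul_smul, inv_mul_cancel₀ RatFunc.X_ne_zero, one_smul]⟩

theorem IsZInvRHInf.isRHInf {ι κ : Type} {G : TransferMatrix ι κ} (hG : IsZInvRHInf G) :
    IsRHInf G := by
  obtain ⟨H, hH, rfl⟩ := hG
  exact EntriesIn.smul inv_X_mem_rhInfRing hH

theorem SLP.satisfiesSLS_iff : Φ.SatisfiesSLS A B C ↔
    ((((RatFunc.X : RatFunc ℝ) • 1 - const A) * Φ.xx - const B * Φ.ux = 1 ∧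
        ((RatFunc.X : RatFunc ℝ) • 1 - const A) * Φ.xy - const B * Φ.uy = 0) ∧
      (Φ.xx * ((RatFunc.X : RatFunc ℝ) • 1 - const A) - Φ.xy * const C = 1 ∧
        Φ.ux * ((RatFunc.X : RatFunc ℝ) • 1 - const A) - Φ.uy * const C = 0)) ∧
      IsZInvRHInf Φ.xx ∧ IsZInvRHInf Φ.xy ∧ IsZInvRHInf Φ.ux ∧ IsRHInf Φ.uy := by
  have h1 : Matrix.fromCols ((RatFunc.X : RatFunc ℝ) • 1 - const A) (-const B) * Φ.toMatrix =
      Matrix.fromCols 1 0 ↔ ((RatFunc.X : RatFunc ℝ) • 1 - const A) * Φ.xx - const B * Φ.ux = 1 ∧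
        ((RatFunc.X : RatFunc ℝ) • 1 - const A) * Φ.xy - const B * Φ.uy = 0 := by
    rw [SLP.toMatrix, Matrix.fromCols_mul_fromBlocks, Matrix.fromCols_inj.eq_iff, Matrix.neg_mul,
      Matrix.neg_mul, ← sub_eq_add_neg, ← sub_eq_add_neg]
  have h2 : Φ.toMatrix * Matrix.fromRows ((RatFunc.X : RatFunc ℝ) • 1 - const A) (-const C) =
      Matrix.fromRows 1 0 ↔ Φ.xx * ((RatFunc.X : RatFunc ℝ) • 1 - const A) - Φ.xy * const C = 1 ∧
        Φ.ux * ((RatFunc.X : RatFunc ℝ) • 1 - const A) - Φ.uy * const C = 0 := by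
    rw [SLP.toMatrix, Matrix.fromBlocks_mul_fromRows, Matrix.fromRows_inj.eq_iff, Matrix.mul_neg,
      Matrix.mul_neg, ← sub_eq_add_neg, ← sub_eq_add_neg]
  rw [← h1, ← h2]
  exact ⟨fun h => ⟨⟨h.left, h.right⟩, h.xx_mem, h.xy_mem, h.ux_mem, h.uy_mem⟩,
    fun h => ⟨h.1.1, h.1.2, h.2.1, h.2.2.1, h.2.2.2.1, h.2.2.2.2⟩⟩

/-- `Φxx = z⁻¹ (I + z⁻¹ P)` with `P` stable proper, so it is invertible and `z⁻¹ Φxx⁻¹` is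
proper. -/
theorem SLP.SatisfiesSLS.isUnit_xx (h : Φ.SatisfiesSLS A B C) :
    IsUnit Φ.xx ∧ IsProper ((RatFunc.X : RatFunc ℝ)⁻¹ • Φ.xx⁻¹) := by
  obtain ⟨⟨⟨h1, -⟩, -⟩, -⟩ := SLP.satisfiesSLS_iff.1 h
  obtain ⟨H, hH, hxx⟩ := h.xx_mem
  obtain ⟨G, hG, hux⟩ := h.ux_mem
  have hP : IsRHInf (const A * H + const B * G) :=
    isRHInf_iff.2 (((entriesIn_const A).mul hH).add ((entriesIn_const B).mul hG))
  have hX : (RatFunc.X : RatFunc ℝ) • Φ.xx =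
      1 + (RatFunc.X : RatFunc ℝ)⁻¹ • (const A * H + const B * G) := by
    rw [Matrix.sub_mul, Matrix.smul_mul, Matrix.one_mul, sub_sub, sub_eq_iff_eq_add] at h1
    rw [h1, smul_add, ← Matrix.mul_smul, ← Matrix.mul_smul, ← hxx, ← hux]
  obtain ⟨hu, hp⟩ := isUnit_one_add_inv_X_smul hP.isProper
  rw [← hX] at hu hp
  have hmul : Φ.xx * ((RatFunc.X : RatFunc ℝ) • ((RatFunc.X : RatFunc ℝ) • Φ.xx)⁻¹) = 1 := by
    rw [Matrix.mul_smul, ← Matrix.smul_mul]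
    exact Matrix.mul_nonsing_inv _ ((Matrix.isUnit_iff_isUnit_det _).1 hu)
  refine ⟨IsUnit.of_mul_eq_one _ hmul, ?_⟩
  rwa [Matrix.inv_eq_right_inv hmul, smul_smul, inv_mul_cancel₀ RatFunc.X_ne_zero, one_smul]

theorem SLP.SatisfiesSLS.isProper_controller₀ (h : Φ.SatisfiesSLS A B C) :
    IsProper Φ.controller₀ := by
  have h1 : Φ.controller₀ = Φ.uy - (RatFunc.X : RatFunc ℝ) • Φ.ux *
      ((RatFunc.X : RatFunc ℝ)⁻¹ • Φ.xx⁻¹) * Φ.xy := by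
    rw [Matrix.smul_mul, Matrix.mul_smul, smul_smul, mul_inv_cancel₀ RatFunc.X_ne_zero, one_smul]
    rfl
  rw [h1, isProper_iff]
  exact (isProper_iff.1 h.uy_mem.isProper).sub
    (((isProper_iff.1 (isZInvRHInf_iff.1 h.ux_mem).isProper).mul
      (isProper_iff.1 h.isUnit_xx.2)).mul (isProper_iff.1 h.xy_mem.isRHInf.isProper))

theorem SLP.SatisfiesSLS.isProper_controller (h : Φ.SatisfiesSLS A B C) (hD : Φ.IsWellPosed D) :
    IsProper (Φ.controller D) :=
  isProper_iff.2 ((isProper_iff.1 h.isProper_controller₀).mul (isProper_iff.1 hD.2))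

/-- The closed-loop response on `(x, u, y)` determined by a system level parameter, where
`y = C x + D u + d_y`. -/
noncomputable def SLP.loop (B : Matrix (Fin n) (Fin m) ℝ) (C : Matrix (Fin p) (Fin n) ℝ)
    (D : Matrix (Fin p) (Fin m) ℝ) (Φ : SLP n m p) :
    TransferMatrix (Fin n ⊕ Fin m ⊕ Fin p) (Fin n ⊕ Fin m ⊕ Fin p) :=
  blocks₃ Φ.xx (Φ.xx * const B + Φ.xy * const D) Φ.xy
    Φ.ux (1 + Φ.ux * const B + Φ.uy * const D) Φ.uy
    (const C * Φ.xx + const D * Φ.ux)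
    (const C * (Φ.xx * const B + Φ.xy * const D) +
      const D * (1 + Φ.ux * const B + Φ.uy * const D))
    (1 + const C * Φ.xy + const D * Φ.uy)

theorem blocks₃_submatrix
    (Sxx : TransferMatrix (Fin n) (Fin n)) (Sxu : TransferMatrix (Fin n) (Fin m))
    (Sxy : TransferMatrix (Fin n) (Fin p))
    (Sux : TransferMatrix (Fin m) (Fin n)) (Suu : TransferMatrix (Fin m) (Fin m))
    (Suy : TransferMatrix (Fin m) (Fin p))
    (Syx : TransferMatrix (Fin p) (Fin n)) (Syu : TransferMatrix (Fin p) (Fin m))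
    (Syy : TransferMatrix (Fin p) (Fin p)) :
    (blocks₃ Sxx Sxu Sxy Sux Suu Suy Syx Syu Syy).submatrix (xuIndex n m p) (xyIndex n m p) =
      SLP.toMatrix ⟨Sxx, Sxy, Sux, Suy⟩ := by
  ext (i | i) (j | j) <;> rfl

theorem SLP.loop_submatrix :
    (Φ.loop B C D).submatrix (xuIndex n m p) (xyIndex n m p) = Φ.toMatrix :=
  blocks₃_submatrix ..

theorem SLP.toMatrix_injective :
    Function.Injective (SLP.toMatrix : SLP n m p → _) := by
  intro Φ Ψ h
  obtain ⟨h1, h2, h3, h4⟩ := Matrix.fromBlocks_inj.1 h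
  exact SLP.ext h1 h2 h3 h4

theorem SLP.SatisfiesSLS.isRHInf_loop (h : Φ.SatisfiesSLS A B C) : IsRHInf (Φ.loop B C D) := by
  have hxx : EntriesIn rhInfRing Φ.xx := h.xx_mem.isRHInf
  have hxy : EntriesIn rhInfRing Φ.xy := h.xy_mem.isRHInf
  have hux : EntriesIn rhInfRing Φ.ux := h.ux_mem.isRHInf
  have huy : EntriesIn rhInfRing Φ.uy := h.uy_mem
  have hB := entriesIn_const B
  have hC := entriesIn_const C
  have hD := entriesIn_const D
  have hxu := (hxx.mul hB).add (hxy.mul hD)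
  have huu := (entriesIn_one.add (hux.mul hB)).add (huy.mul hD)
  exact entriesIn_blocks₃.2 ⟨⟨hxx, hxu, hxy⟩, ⟨hux, huu, huy⟩,
    (hC.mul hxx).add (hD.mul hux), (hC.mul hxu).add (hD.mul huu),
    (entriesIn_one.add (hC.mul hxy)).add (hD.mul huy)⟩

/-- The controller of a system level parameter realizes its closed-loop response. -/
theorem SLP.SatisfiesSLS.one_sub_realization_mul_loop (h : Φ.SatisfiesSLS A B C)
    (hD : Φ.IsWellPosed D) :
    (1 - realization (const A) (const B) (const C) (const D) (Φ.controller D)) *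
      Φ.loop B C D = 1 := by
  obtain ⟨⟨⟨h1, h2⟩, ⟨h3, h4⟩⟩, -⟩ := SLP.satisfiesSLS_iff.1 h
  have hxx := (Matrix.isUnit_iff_isUnit_det _).1 h.isUnit_xx.1
  set K₀ := Φ.controller₀ with hK₀
  set K := Φ.controller D with hK
  have hKL : K * (1 + const D * K₀) = K₀ :=
    Matrix.nonsing_inv_mul_cancel_right _ _ ((Matrix.isUnit_iff_isUnit_det _).1 hD.1)
  have e1 : K₀ * const C * Φ.xx = Φ.ux := by
    have e2 : K₀ * const C = Φ.ux * Φ.xx⁻¹ := by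
      generalize (RatFunc.X : RatFunc ℝ) • (1 : TransferMatrix (Fin n) (Fin n)) - const A = Z
        at h3 h4
      rw [hK₀, SLP.controller₀, Matrix.sub_mul, Matrix.mul_assoc _ Φ.xy, ← sub_eq_zero.1 h4,
        ← sub_eq_iff_eq_add'.2 (sub_eq_iff_eq_add.1 h3), Matrix.mul_sub, Matrix.mul_one,
        ← Matrix.mul_assoc, Matrix.nonsing_inv_mul_cancel_right _ _ hxx, sub_sub_cancel]
    rw [e2, Matrix.nonsing_inv_mul_cancel_right _ _ hxx]
  have e3 : K₀ * (1 + const C * Φ.xy) = Φ.uy := by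
    have : K₀ = Φ.uy - K₀ * const C * Φ.xy := by
      conv_rhs => rw [← Matrix.mul_nonsing_inv_cancel_right _ (K₀ * const C) hxx, e1]
      rfl
    rw [Matrix.mul_add, Matrix.mul_one, ← Matrix.mul_assoc]
    nth_rewrite 1 [this]
    rw [sub_add_cancel]
  have hux : K * (const C * Φ.xx + const D * Φ.ux) = Φ.ux := by
    calc K * (const C * Φ.xx + const D * Φ.ux)
        = K * (1 + const D * K₀) * const C * Φ.xx := by
          nth_rewrite 1 [← e1]
          simp only [Matrix.mul_add, Matrix.add_mul, Matrix.mul_one, Matrix.mul_assoc]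
      _ = Φ.ux := by rw [hKL, e1]
  have huy : K * (1 + const C * Φ.xy + const D * Φ.uy) = Φ.uy := by
    calc K * (1 + const C * Φ.xy + const D * Φ.uy)
        = K * (1 + const D * K₀) * (1 + const C * Φ.xy) := by
          nth_rewrite 1 [← e3]
          rw [Matrix.mul_assoc K, Matrix.add_mul 1 (const D * K₀), Matrix.one_mul,
            Matrix.mul_assoc (const D)]
      _ = Φ.uy := by rw [hKL, e3]
  rw [one_sub_realization, SLP.loop, blocks₃_mul, blocks₃_eq_one_iff]
  simp only [Matrix.neg_mul, Matrix.zero_mul, Matrix.one_mul, zero_add, add_zero,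
    ← sub_eq_add_neg]
  refine ⟨⟨h1, ?_, h2⟩, ⟨?_, ?_, ?_⟩, ?_, ?_, ?_⟩
  · calc _ = (((RatFunc.X : RatFunc ℝ) • 1 - const A) * Φ.xx - const B * Φ.ux) * const B +
          (((RatFunc.X : RatFunc ℝ) • 1 - const A) * Φ.xy - const B * Φ.uy) * const D -
          const B := by
          simp only [Matrix.mul_add, Matrix.sub_mul, Matrix.mul_assoc, Matrix.mul_one]
          abel
      _ = 0 := by rw [h1, h2, Matrix.one_mul, Matrix.zero_mul, add_zero, sub_self]
  · rw [hux, sub_self]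
  · -- the `u` column of the loop is the combination of the other two with weights `B` and `D`
    have : const C * (Φ.xx * const B + Φ.xy * const D) +
        const D * (1 + Φ.ux * const B + Φ.uy * const D) =
        (const C * Φ.xx + const D * Φ.ux) * const B +
          (1 + const C * Φ.xy + const D * Φ.uy) * const D := by
      simp only [Matrix.mul_add, Matrix.add_mul, Matrix.mul_assoc, Matrix.mul_one, Matrix.one_mul]
      abel
    rw [this, Matrix.mul_add, ← Matrix.mul_assoc, ← Matrix.mul_assoc, hux, huy]
    abel
  · rw [huy, sub_self]
  · abel
  · abel
  · abel

/-- The closed-loop response of a stabilizing controller yields a system level parameter that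
satisfies the constraints and from which the controller is recovered. -/
theorem exists_SLP_of_internallyStabilizes (hK : IsProper K)
    {S : TransferMatrix (Fin n ⊕ Fin m ⊕ Fin p) (Fin n ⊕ Fin m ⊕ Fin p)}
    (hMS : (1 - realization (const A) (const B) (const C) (const D) K) * S = 1)
    (hS : IsRHInf S) :
    ∃ Φ : SLP n m p, S.submatrix (xuIndex n m p) (xyIndex n m p) = Φ.toMatrix ∧
      Φ.SatisfiesSLS A B C ∧ Φ.IsWellPosed D ∧ Φ.controller D = K := by
  have hSM := mul_eq_one_comm.1 hMS
  obtain ⟨Sxx, Sxu, Sxy, Sux, Suu, Suy, Syx, Syu, Syy, rfl⟩ := exists_eq_blocks₃ S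
  obtain ⟨⟨hxx, -, hxy⟩, ⟨hux, -, huy⟩, -⟩ := entriesIn_blocks₃.1 (isRHInf_iff.1 hS)
  rw [one_sub_realization, blocks₃_mul, blocks₃_eq_one_iff] at hMS hSM
  simp only [Matrix.neg_mul, Matrix.mul_neg, Matrix.zero_mul, Matrix.mul_zero, Matrix.one_mul,
    Matrix.mul_one, zero_add, add_zero, zero_sub, ← sub_eq_add_neg] at hMS hSM
  obtain ⟨⟨h1, -, h2⟩, ⟨h3, -, h4⟩, ⟨h5, -, h6⟩⟩ := hMS
  obtain ⟨⟨h7, -, -⟩, ⟨h8, -, -⟩, -⟩ := hSM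
  have hA := entriesIn_const A
  have hB := entriesIn_const B
  have hC := entriesIn_const C
  have hsls : (⟨Sxx, Sxy, Sux, Suy⟩ : SLP n m p).SatisfiesSLS A B C := by
    refine SLP.satisfiesSLS_iff.2 ⟨⟨⟨h1, h2⟩, h7, h8⟩, isZInvRHInf_iff.2 ?_, isZInvRHInf_iff.2 ?_,
      isZInvRHInf_iff.2 ?_, huy⟩
    · have : (RatFunc.X : RatFunc ℝ) • Sxx = 1 + (const A * Sxx + const B * Sux) := by
        rw [← h1, Matrix.sub_mul, Matrix.smul_mul, Matrix.one_mul]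
        abel
      exact this ▸ entriesIn_one.add ((hA.mul hxx).add (hB.mul hux))
    · have : (RatFunc.X : RatFunc ℝ) • Sxy = const A * Sxy + const B * Suy := by
        rw [← sub_eq_zero, ← h2, Matrix.sub_mul, Matrix.smul_mul, Matrix.one_mul]
        abel
      exact this ▸ (hA.mul hxy).add (hB.mul huy)
    · have : (RatFunc.X : RatFunc ℝ) • Sux = Sux * const A + Suy * const C := by
        rw [← sub_eq_zero, ← h8, Matrix.mul_sub, Matrix.mul_smul, Matrix.mul_one]
        abel
      exact this ▸ (hux.mul hA).add (huy.mul hC)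
  refine ⟨⟨Sxx, Sxy, Sux, Suy⟩, blocks₃_submatrix .., hsls, ?_⟩
  have hu := (Matrix.isUnit_iff_isUnit_det _).1 hsls.isUnit_xx.1
  set K₀ := (⟨Sxx, Sxy, Sux, Suy⟩ : SLP n m p).controller₀ with hK₀
  have hK₀' : K₀ = Suy - Sux * Sxx⁻¹ * Sxy := rfl
  -- `1 + D K₀` is the Schur complement `Syy - Syx Sxx⁻¹ Sxy`
  have hL : 1 + const D * K₀ = Syy - Syx * Sxx⁻¹ * Sxy := by
    have hyx : Syx = const C * Sxx + const D * Sux := by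
      rw [← sub_eq_zero, ← h5]
      abel
    have hyy : Syy = 1 + const C * Sxy + const D * Suy := by
      rw [← h6]
      abel
    rw [hyx, hyy, hK₀', Matrix.add_mul, Matrix.add_mul, Matrix.mul_nonsing_inv_cancel_right _ _ hu,
      Matrix.mul_sub]
    simp only [Matrix.mul_assoc]
    abel
  have hKL : K * (1 + const D * K₀) = K₀ := by
    rw [hL, hK₀', sub_eq_zero.1 h3, sub_eq_zero.1 h4]
    simp only [Matrix.mul_sub, Matrix.mul_assoc]
  have hinv : (1 + const D * K₀) * (1 - const D * K) = 1 := by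
    rw [mul_eq_one_comm, Matrix.sub_mul, Matrix.one_mul, Matrix.mul_assoc, hKL, add_sub_cancel_right]
  have hunit : IsUnit (1 + const D * K₀) := IsUnit.of_mul_eq_one _ hinv
  refine ⟨⟨hunit, ?_⟩, ?_⟩
  · rw [Matrix.inv_eq_right_inv hinv]
    have hD : IsRHInf (const D) := entriesIn_const D
    exact isProper_iff.2 (entriesIn_one.sub ((isProper_iff.1 hD.isProper).mul (isProper_iff.1 hK)))
  · rw [SLP.controller, ← hK₀]
    nth_rewrite 1 [← hKL]
    exact Matrix.mul_nonsing_inv_cancel_right _ _ ((Matrix.isUnit_iff_isUnit_det _).1 hunit)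

end Nominal

end RobustSLS

theorem mainTheorem3 (n m p : ℕ)
    (A : Matrix (Fin n) (Fin n) ℝ) (B : Matrix (Fin n) (Fin m) ℝ)
    (C : Matrix (Fin p) (Fin n) ℝ) (D : Matrix (Fin p) (Fin m) ℝ)
    (ε : ℝ) (hε : 0 < ε) :
    Set.BijOn (fun Φ : RobustSLS.SLP n m p => Φ.controller D)
      (RobustSLS.robustSLPs A B C D ε) (RobustSLS.robustControllers A B C D ε) := by
  open RobustSLS in
  refine ⟨?_, ?_, ?_⟩
  · rintro Φ ⟨hΦ, hD, hnorm⟩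
    refine ⟨hΦ.isProper_controller hD, fun ΔA ΔB ΔC ΔD hA hB hC hD' hΔ => ?_⟩
    refine internallyStabilizes_add_of_norm_le (hΦ.one_sub_realization_mul_loop hD)
      hΦ.isRHInf_loop hε ?_ hA hB hC hD' hΔ
    rw [SLP.loop_submatrix]
    exact (hInfNorm_le_ofReal (inv_pos.2 hε).le).1 hnorm
  · rintro Φ ⟨hΦ, hD, -⟩ Ψ ⟨hΨ, hD', -⟩ (h : Φ.controller D = Ψ.controller D)
    -- both responses invert the same matrix
    have h1 := hΦ.one_sub_realization_mul_loop hD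
    have h2 := mul_eq_one_comm.1 (hΨ.one_sub_realization_mul_loop hD')
    rw [← h] at h2
    apply SLP.toMatrix_injective
    rw [← SLP.loop_submatrix (B := B) (C := C) (D := D), ← left_inv_eq_right_inv h2 h1,
      SLP.loop_submatrix]
  · rintro K ⟨hK, h⟩
    have h0 : hInfNorm (structuredPerturbation (0 : TransferMatrix (Fin n) (Fin n))
        (0 : TransferMatrix (Fin n) (Fin m)) (0 : TransferMatrix (Fin p) (Fin n))
        (0 : TransferMatrix (Fin p) (Fin m))) < ENNReal.ofReal ε := by
      simp [structuredPerturbation, blocks₃, hInfNorm_zero, hε]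
    obtain ⟨S, hMS, -, hS⟩ := h 0 0 0 0 isRHInf_zero isRHInf_zero isRHInf_zero isRHInf_zero h0
    simp only [add_zero] at hMS
    obtain ⟨Φ, hSΦ, hΦ, hD, hΦK⟩ := exists_SLP_of_internallyStabilizes hK hMS hS
    refine ⟨Φ, ⟨hΦ, hD, ?_⟩, hΦK⟩
    rw [hInfNorm_le_ofReal (inv_pos.2 hε).le, ← hSΦ]
    exact norm_le_of_internallyStabilizes_add hMS hS hε h
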